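/- Let $D\ge 2$. For finite $X\subset\mathbb Z$ let $\mathcal A_X=\bigotimes_{x\in X}M_D(\mathbb C)$ with the operator norm, identified for $X\subset Y$ with the subalgebra $\mathcal A_X\otimes 1_{Y\setminus X}$ of $\mathcal A_Y$, and write $\mathcal A_L=\mathcal A_{[-L,L]}$ for $L\in\mathbb N$. Let $\Phi$ be a nearest-neighbor interaction, that is, $\Phi_{x,x+1}=\Phi_{x,x+1}^*\in\mathcal A_{\{x,x+1\}}$ for $x\in\mathbb Z$, with $\|\Phi\|=\sup_x\|\Phi_{x,x+1}\|<\infty$. Let $\mu>0$ and $$v=8e^{\mu}K_\mu\|\Phi\|,\qquad K_\mu=\sup_{x,y\in\mathbb Z}\sum_{z\in\mathbb Z}\frac{e^{-\mu(|x-z|+|y-z|-|x-y|)}(1+|x-y|)^2}{(1+|x-z|)^2(1+|z-y|)^2}.$$ Let $V_0=V_0^*\in\mathcal A_{\{0\}}$ have $D$ distinct eigenvalues. Then there is a constant $K>0$, depending only on $\mu$, $D$, $\Phi$ and $V_0$, such that the following holds. Let $\mathcal F\subset\mathbb Z$ have minimal spacing $\sigma_{\mathcal F}=\inf\{|x-y|:x,y\in\mathcal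 F,\ x\ne y\}>\max\{1/\mu,2\}$ (with $\inf\emptyset=\infty$), let $\lambda\in\mathbb R\setminus\{0\}$, and for $x\in\mathcal F$ let $V_x=T_x(V_0)\in\mathcal A_{\{x\}}$ be the translate of $V_0$ to the site $x$. For $L\in\mathbb N$ let $$H_L(\lambda)=\sum_{x=-L}^{L-1}\Phi_{x,x+1}+\lambda\sum_{x\in\mathcal F\cap[-L,L]}V_x,\qquad \tau_t(A)=e^{itH_L(\lambda)}Ae^{-itH_L(\lambda)}.$$ For $A\in\mathcal A_L$ let the support $S_A$ be the nonempty interval $[x,y]$ of minimal length such that $A\in\mathcal A_{[x,y]}$ (any such interval, if $A$ is a multiple of the identity), and let $d$ denote the distance between subsets of $\mathbb Z$. Then for all $L\in\mathbb N$, all $A,B\in\mathcal A_L$ with $\max S_A+3<\min S_B-3$, and all $t\in\mathbb R$, $$\|[\tau_t(A),B]\|\le\left(K\,\frac{\mu\, d(S_A,S_B)\,(1+v|t|)}{|\lambda|}\right)^{N}\|A\|\,\|B\|\,e^{v|t|}\,e^{-\mu d(S_A,S_B)},$$ where $N$ is the number of elements of $\mathcal F\cap[\max S_A+3,\ \min S_B-3]$.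 -/

import Mathlib

open scoped Matrix.Norms.L2Operator

namespace SpinChain

/-- The observable algebra `𝒜_X = ⨂_{x ∈ X} M_D(ℂ)` of a finite set `X` of sites, realised as the
algebra of all matrices on `⨂_{x ∈ X} ℂ^D`, whose standard basis is indexed by the configurations
`X → Fin D`. It carries the operator norm of the Hilbert space `⨂_{x ∈ X} ℂ^D`
(the scoped instances of `Matrix.Norms.L2Operator`). -/
abbrev LocalAlg (D : ℕ) (X : Finset ℤ) : Type :=
  Matrix (X → Fin D) (X → Fin D) ℂ

/-- Restriction of a configuration on `Y` to `X ⊆ Y`. -/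
def restrictConfig {D : ℕ} {X Y : Finset ℤ} (h : X ⊆ Y) (s : Y → Fin D) : X → Fin D :=
  fun x => s ⟨x, h x.2⟩

/-- The inclusion `𝒜_X → 𝒜_Y`, `A ↦ A ⊗ 𝟙_{Y ∖ X}`, for `X ⊆ Y`. -/
def embed {D : ℕ} {X Y : Finset ℤ} (h : X ⊆ Y) (A : LocalAlg D X) : LocalAlg D Y :=
  fun s t =>
    if ∀ y : Y, (y : ℤ) ∉ X → s y = t y then A (restrictConfig h s) (restrictConfig h t) else 0

/-- Translation by `x` as a map `𝒜_X → 𝒜_Y`, where `Y = X + x`. -/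
def translate {D : ℕ} (x : ℤ) {X Y : Finset ℤ} (h : ∀ y, y ∈ X ↔ y + x ∈ Y)
    (A : LocalAlg D X) : LocalAlg D Y :=
  fun s t => A (fun y => s ⟨y + x, (h y).1 y.2⟩) (fun y => t ⟨y + x, (h y).1 y.2⟩)

/-- The translation `T_x` as a map `𝒜_{{0}} → 𝒜_{{x}}`. -/
def translateSite {D : ℕ} (x : ℤ) (A : LocalAlg D {0}) : LocalAlg D {x} :=
  translate x (by simp) A

/-- A self-adjoint operator on one site whose `D` eigenvalues are pairwise distinct
(`Matrix.IsHermitian.eigenvalues` lists the eigenvalues with multiplicity). -/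
def IsNondegenerate {D : ℕ} {x : ℤ} (V : LocalAlg D {x}) : Prop :=
  ∃ hV : V.IsHermitian, Function.Injective hV.eigenvalues

/-- An interaction: a self-adjoint element of `𝒜_X` for every finite `X ⊆ ℤ`. -/
structure Interaction (D : ℕ) where
  /-- the local terms -/
  term : ∀ X : Finset ℤ, LocalAlg D X
  /-- the local terms are self-adjoint -/
  isHermitian : ∀ X, (term X).IsHermitian

namespace Interaction

variable {D : ℕ}

/-- The only nonzero terms are those on the bonds `{x, x+1}`. -/
def IsNearestNeighbor (Φ : Interaction D) : Prop :=
  ∀ X : Finset ℤ, Φ.term X ≠ 0 → ∃ x : ℤ, X = {x, x + 1}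

/-- The bond term `Φ_{x,x+1}`. -/
def bond (Φ : Interaction D) (x : ℤ) : LocalAlg D {x, x + 1} :=
  Φ.term {x, x + 1}

/-- `sup_x ‖Φ_{x,x+1}‖ < ∞`. -/
def IsBounded (Φ : Interaction D) : Prop :=
  BddAbove (Set.range fun x : ℤ => ‖Φ.bond x‖)

/-- `‖Φ‖ = sup_x ‖Φ_{x,x+1}‖` (used for bounded `Φ` only). -/
noncomputable def bondNorm (Φ : Interaction D) : ℝ :=
  ⨆ x : ℤ, ‖Φ.bond x‖

end Interaction

/-- The volume `[-L, L]`. -/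
noncomputable def box (L : ℕ) : Finset ℤ := Finset.Icc (-(L : ℤ)) L

theorem bond_subset_box {L : ℕ} {x : ℤ} (hx : x ∈ Finset.Ico (-(L : ℤ)) L) :
    ({x, x + 1} : Finset ℤ) ⊆ box L := by
  intro y hy
  simp only [Finset.mem_insert, Finset.mem_singleton] at hy
  simp only [Finset.mem_Ico] at hx
  simp only [box, Finset.mem_Icc]
  omega

/-- `H_L(Φ) = ∑_{x=-L}^{L-1} Φ_{x,x+1}`. -/
noncomputable def bulkHamiltonian {D : ℕ} (Φ : Interaction D) (L : ℕ) : LocalAlg D (box L) :=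
  ∑ x : Finset.Ico (-(L : ℤ)) L, embed (bond_subset_box x.2) (Φ.bond x)

open Classical in
/-- `V_L(λ) = ∑_{x ∈ F ∩ [-L,L]} λ_x V_x`. -/
noncomputable def impurityHamiltonian {D : ℕ} (F : Set ℤ) (V : ∀ x : ℤ, LocalAlg D {x})
    (lam : ℤ → ℝ) (L : ℕ) : LocalAlg D (box L) :=
  ∑ x : box L,
    if (x : ℤ) ∈ F then
      (lam x : ℂ) • embed (Finset.singleton_subset_iff.2 x.2) (V x)
    else 0

/-- `H_L(λ) = H_L(Φ) + V_L(λ)`. -/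
noncomputable def hamiltonian {D : ℕ} (Φ : Interaction D) (F : Set ℤ)
    (V : ∀ x : ℤ, LocalAlg D {x}) (lam : ℤ → ℝ) (L : ℕ) : LocalAlg D (box L) :=
  bulkHamiltonian Φ L + impurityHamiltonian F V lam L

/-- The Heisenberg evolution `τ_t^H(A) = e^{itH} A e^{-itH}`. -/
noncomputable def heisenberg {D : ℕ} {X : Finset ℤ} (H : LocalAlg D X) (t : ℝ)
    (A : LocalAlg D X) : LocalAlg D X :=
  NormedSpace.exp ((Complex.I * (t : ℂ)) • H) * A * NormedSpace.exp (-((Complex.I * (t : ℂ)) • H))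

/-- `A ∈ 𝒜_X`, for an element `A` of `𝒜_Y`. -/
def IsSupportedOn {D : ℕ} {Y : Finset ℤ} (A : LocalAlg D Y) (X : Finset ℤ) : Prop :=
  ∃ (h : X ⊆ Y) (A₀ : LocalAlg D X), embed h A₀ = A

/-- `[a, a']` is the support of `A`: a nonempty interval of minimal length among those with
`A ∈ 𝒜_{[a, a']}`. (It is unique unless `A` is a multiple of the identity, in which case every
one-point interval qualifies.) -/
def IsSupport {D : ℕ} {Y : Finset ℤ} (A : LocalAlg D Y) (a a' : ℤ) : Prop :=
  a ≤ a' ∧ IsSupportedOn A (Finset.Icc a a') ∧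
    ∀ c c' : ℤ, c ≤ c' → IsSupportedOn A (Finset.Icc c c') → a' - a ≤ c' - c

/-- `d(X, Y) = inf_{x ∈ X, y ∈ Y} |x - y|` (used for nonempty sets only). -/
noncomputable def setDist (X Y : Set ℤ) : ℝ :=
  sInf {r : ℝ | ∃ x ∈ X, ∃ y ∈ Y, r = |(x : ℝ) - (y : ℝ)|}

/-- The constant
`K_μ = sup_{x,y} ∑_z e^{-μ(|x-z|+|y-z|-|x-y|)} (1+|x-y|)² / ((1+|x-z|)² (1+|z-y|)²)`. For `μ > 0`
every series converges and the sums are bounded uniformly in `x` and `y`. -/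
noncomputable def convConst (μ : ℝ) : ℝ :=
  ⨆ p : ℤ × ℤ, ∑' z : ℤ,
    Real.exp (-μ * (|(p.1 : ℝ) - z| + |(p.2 : ℝ) - z| - |(p.1 : ℝ) - p.2|)) *
        (1 + |(p.1 : ℝ) - p.2|) ^ 2 /
      ((1 + |(p.1 : ℝ) - z|) ^ 2 * (1 + |(z : ℝ) - p.2|) ^ 2)

/-- The Lieb-Robinson exponent `v = 8 e^μ K_μ ‖Φ‖`. -/
noncomputable def velocity {D : ℕ} (μ : ℝ) (Φ : Interaction D) : ℝ :=
  8 * Real.exp μ * convConst μ * Φ.bondNorm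

end SpinChain

/-!
A strong impurity at a site `x` slows down the propagation of information because the part of the two
bonds at `x` that does not commute with `V_x` oscillates with frequencies of order `λ`, whereas the
part that commutes with `V_x` does not transport anything past `x`.

The commutators are estimated by sweeping from the support of `A` to the support of `B`. Let `f_k(t)`
be the best constant in `‖[τ_t(A), B]‖ ≤ f_k(t) ‖A‖` for `A` supported on the sites `≤ k`.

* Crossing an arbitrary bond: evolving `A` backwards with the Hamiltonian to the left of the bond
  leaves only the bond `(k, k + 1)` in Duhamel's formula, whence
  `f_k(t) ≤ 2 ‖Φ‖ ∫_0^t f_{k+1}(s) ds` (`Chain.commBound_of_add_one`).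
* Crossing an impurity: let `P_i` be the spectral projections of `V_x`. They have rank one on the site,
  because the spectrum is nondegenerate, so the pinched bonds `∑_i P_i Φ P_i` belong to the algebras
  generated by the `P_i` and one of the two sides of `x`. The dynamics with pinched bonds therefore
  preserves the algebra `N` generated by the sites `< x` and the `P_i`. The rest `O` of the two bonds is
  off-diagonal and equals `[T, λ V_x]` with `T = O(1/λ)` supported on `[x - 1, x + 1]`. For `a ∈ N` the
  contribution of `O` to the derivative of `τ_t(a + [T, a])` is cancelled, and what remains are
  double commutators with `T` of size `O(1/λ)`, supported on the sites `≤ x + 2`. This gives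
  `f_{x-1}(t) ≤ (C / |λ|) (1 + t) f_{x+2}(t)` (`Chain.commBound_of_impurity`).

Since the impurities are at least three sites apart, the two steps can be combined
(`Chain.exists_commBound`): at distance `d` with `N` impurities in between,
`f(t) ≤ 2 ‖B‖ (C (1 + t) / |λ|) ^ N (2 ‖Φ‖ t) ^ m / m!` with `m = d - 3 N ≥ 1`. As `K_μ ≥ 1`, the
exponent `v` is at least `8 e^μ ‖Φ‖`, so the last factor is at most `e^{v t} e^{-μ (d - 3 N)} / 2`, and
the factors `e^{3 μ}` are absorbed in `K`.

The estimates are carried out for an abstract chain in a C*-algebra, in which the observables on the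
sites `≤ k` are the commutant of those on the sites `> k`; the spin system on `[-L, L]` is such a chain.
-/

namespace SpinChain

/-! ### Dynamics in a C*-algebra -/

section Dynamics

variable {𝔸 : Type*} [CStarAlgebra 𝔸]

/-- The Heisenberg evolution `e^{itH} A e^{-itH}` in a C*-algebra. -/
noncomputable def evolve (H : 𝔸) (t : ℝ) (A : 𝔸) : 𝔸 :=
  NormedSpace.exp ((Complex.I * (t : ℂ)) • H) * A * NormedSpace.exp (-((Complex.I * (t : ℂ)) • H))

theorem norm_lie_le (a b : 𝔸) : ‖⁅a, b⁆‖ ≤ 2 * ‖a‖ * ‖b‖ := by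
  rw [Ring.lie_def]
  have h1 := norm_sub_le (a * b) (b * a)
  have h2 := norm_mul_le a b
  have h3 := norm_mul_le b a
  nlinarith

theorem norm_evolve {H : 𝔸} (hH : IsSelfAdjoint H) (t : ℝ) (A : 𝔸) :
    ‖evolve H t A‖ = ‖A‖ := by
  let _ : NormedAlgebra ℚ 𝔸 := NormedAlgebra.restrictScalars ℚ ℂ 𝔸
  have hs : ∀ r : ℝ, (Complex.I * (r : ℂ)) • H ∈ skewAdjoint 𝔸 := by
    intro r
    rw [skewAdjoint.mem_iff, star_smul, hH.star_eq]
    simp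
  have h1 := NormedSpace.exp_mem_unitary_of_mem_skewAdjoint (hs t)
  have h2 := NormedSpace.exp_mem_unitary_of_mem_skewAdjoint (neg_mem (hs t))
  rw [evolve, CStarRing.norm_mul_mem_unitary _ h2, CStarRing.norm_mem_unitary_mul _ h1]

theorem evolve_add (H : 𝔸) (t : ℝ) (A B : 𝔸) :
    evolve H t (A + B) = evolve H t A + evolve H t B := by
  simp [evolve, mul_add, add_mul]

@[simp] theorem evolve_zero (H A : 𝔸) : evolve H 0 A = A := by
  simp [evolve]

theorem evolve_neg_neg (H : 𝔸) (t : ℝ) (A : 𝔸) : evolve (-H) (-t) A = evolve H t A := by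
  simp [evolve]

theorem evolve_neg_evolve (H : 𝔸) (t : ℝ) (A : 𝔸) : evolve (-H) t (evolve H t A) = A := by
  let _ : NormedAlgebra ℚ 𝔸 := NormedAlgebra.restrictScalars ℚ ℂ 𝔸
  have h1 := NormedSpace.exp_add_of_commute
    ((Commute.refl ((Complex.I * (t : ℂ)) • H)).neg_left)
  rw [neg_add_cancel, NormedSpace.exp_zero] at h1
  simp only [evolve, smul_neg, neg_neg]
  rw [show ∀ a b c : 𝔸, a * (b * c * a) * b = (a * b) * c * (a * b) by intros; noncomm_ring, ← h1]
  simp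

theorem evolve_mem_centralizer {s : Set 𝔸} {H A : 𝔸} (hH : H ∈ Subalgebra.centralizer ℂ s)
    (hA : A ∈ Subalgebra.centralizer ℂ s) (t : ℝ) :
    evolve H t A ∈ Subalgebra.centralizer ℂ s := by
  rw [Subalgebra.mem_centralizer_iff] at *
  intro y hy
  have h1 : Commute y ((Complex.I * (t : ℂ)) • H) := Commute.smul_right (hH y hy) _
  exact ((h1.exp_right.mul_right (hA y hy)).mul_right h1.neg_right.exp_right).eq

theorem hasDerivAt_evolve (H : 𝔸) {c : ℝ → 𝔸} {c' : 𝔸} {t : ℝ} (hc : HasDerivAt c c' t) :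
    HasDerivAt (fun s => evolve H s (c s)) (evolve H t (c' + Complex.I • ⁅H, c t⁆)) t := by
  have h1 : HasDerivAt (fun s : ℝ => NormedSpace.exp ((Complex.I * (s : ℂ)) • H))
      (NormedSpace.exp ((Complex.I * (t : ℂ)) • H) * (Complex.I • H)) t := by
    have := hasDerivAt_exp_smul_const (𝕂 := ℝ) (Complex.I • H) t
    simpa only [mul_comm Complex.I, mul_smul, Complex.coe_smul] using! this
  have h2 : HasDerivAt (fun s : ℝ => NormedSpace.exp (-((Complex.I * (s : ℂ)) • H)))
      ((-(Complex.I • H)) * NormedSpace.exp (-((Complex.I * (t : ℂ)) • H))) t := by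
    have := hasDerivAt_exp_smul_const' (𝕂 := ℝ) (-(Complex.I • H)) t
    simpa only [mul_comm Complex.I, mul_smul, Complex.coe_smul, smul_neg] using! this
  have h3 := (h1.mul hc).mul h2
  refine h3.congr_deriv ?_
  have h4 : Complex.I • ⁅H, c t⁆ = (Complex.I • H) * c t - c t * (Complex.I • H) := by
    rw [Ring.lie_def, smul_sub, smul_mul_assoc, mul_smul_comm]
  rw [evolve, h4, Pi.mul_apply]
  noncomm_ring

theorem hasDerivAt_evolve_const (H X : 𝔸) (t : ℝ) :
    HasDerivAt (fun s => evolve H s X) (Complex.I • ⁅H, evolve H t X⁆) t := by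
  refine (hasDerivAt_evolve H (hasDerivAt_const t X)).congr_deriv ?_
  have h1 : Commute H ((Complex.I * (t : ℂ)) • H) := (Commute.refl H).smul_right _
  have h2 := h1.exp_right.eq
  have h3 := h1.neg_right.exp_right.eq
  simp only [evolve, zero_add, mul_smul_comm, smul_mul_assoc, Ring.lie_def, mul_sub, sub_mul]
  congr 2
  · simp only [← mul_assoc, h2]
  · simp only [mul_assoc, h3]

/-- Duhamel estimate for the commutator of an evolved, time-dependent observable `c s` with a fixed
observable `B`: only the part `e s` of `d/ds c s` that the evolution does not compensate counts. -/
theorem norm_lie_evolve_le {H B : 𝔸} {c e : ℝ → 𝔸} {g g' : ℝ → ℝ} {t : ℝ} (ht : 0 ≤ t)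
    (hc : ∀ s, HasDerivAt c (e s - Complex.I • ⁅H, c s⁆) s) (h0 : ⁅c 0, B⁆ = 0) (hg0 : 0 ≤ g 0)
    (hg : ∀ s, HasDerivAt g (g' s) s)
    (he : ∀ s, 0 ≤ s → s < t → ‖⁅evolve H s (e s), B⁆‖ ≤ g' s) :
    ‖⁅evolve H t (c t), B⁆‖ ≤ g t := by
  have hd : ∀ s, HasDerivAt (fun s => ⁅evolve H s (c s), B⁆) ⁅evolve H s (e s), B⁆ s := by
    intro s
    have h := hasDerivAt_evolve H (hc s)
    rw [sub_add_cancel] at h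
    simp only [Ring.lie_def]
    exact (h.mul_const B).sub (h.const_mul B)
  refine image_norm_le_of_norm_deriv_right_le_deriv_boundary
    (f := fun s => ⁅evolve H s (c s), B⁆) (a := 0) (b := t)
    (fun s _ => (hd s).continuousAt.continuousWithinAt) (fun s _ => (hd s).hasDerivWithinAt)
    (by simpa [h0] using hg0) hg (fun s hs => he s hs.1 hs.2) ⟨ht, le_rfl⟩

theorem lie_mem_subalgebra {S : Subalgebra ℂ 𝔸} {a b : 𝔸} (ha : a ∈ S) (hb : b ∈ S) :
    ⁅a, b⁆ ∈ S := by
  rw [Ring.lie_def]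
  exact sub_mem (mul_mem ha hb) (mul_mem hb ha)

end Dynamics

/-! ### Chains and the crossing of a bond -/

/-- A nearest-neighbour chain in a C*-algebra `𝔸`. The geometry is recorded by the decreasing
family of algebras `right k` of observables on the sites `≥ k`; the observables on the sites `≤ k`
are taken to be the commutant of `right (k + 1)`. -/
structure Chain (𝔸 : Type*) [CStarAlgebra 𝔸] where
  /-- the observables on the sites `≥ k` -/
  right : ℤ → Subalgebra ℂ 𝔸
  right_anti : Antitone right
  /-- the interaction of the sites `j` and `j + 1` -/
  bond : ℤ → 𝔸
  /-- the on-site term -/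
  site : ℤ → 𝔸
  /-- a finite volume that contains all nonzero terms -/
  vol : Finset ℤ
  bond_sa : ∀ j, IsSelfAdjoint (bond j)
  site_sa : ∀ j, IsSelfAdjoint (site j)
  bond_right : ∀ j, bond j ∈ right j
  bond_left : ∀ j, bond j ∈ Subalgebra.centralizer ℂ (right (j + 2) : Set 𝔸)
  site_right : ∀ j, site j ∈ right j
  site_left : ∀ j, site j ∈ Subalgebra.centralizer ℂ (right (j + 1) : Set 𝔸)
  bond_vol : ∀ j, j ∉ vol → bond j = 0
  site_vol : ∀ j, j ∉ vol → site j = 0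

namespace Chain

variable {𝔸 : Type*} [CStarAlgebra 𝔸] (S : Chain 𝔸)

/-- The observables on the sites `≤ k`, as a commutant. -/
def left (k : ℤ) : Subalgebra ℂ 𝔸 := Subalgebra.centralizer ℂ (S.right (k + 1) : Set 𝔸)

/-- The Hamiltonian of the chain. -/
noncomputable def ham : 𝔸 := ∑ j ∈ S.vol, (S.bond j + S.site j)

/-- The part of the Hamiltonian whose bonds and sites are indexed by `j < k`. -/
noncomputable def hamBelow (k : ℤ) : 𝔸 := ∑ j ∈ S.vol with j < k, (S.bond j + S.site j)

/-- The part of the Hamiltonian whose bonds and sites are indexed by `j > k`. -/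
noncomputable def hamAbove (k : ℤ) : 𝔸 := ∑ j ∈ S.vol with k < j, (S.bond j + S.site j)

variable {S}

theorem mem_left {k : ℤ} {a : 𝔸} : a ∈ S.left k ↔ ∀ y ∈ S.right (k + 1), y * a = a * y := by
  simp [left, Subalgebra.mem_centralizer_iff]

theorem lie_eq_zero_of_left {j k : ℤ} (h : j < k) {a y : 𝔸} (ha : a ∈ S.left j)
    (hy : y ∈ S.right k) : ⁅a, y⁆ = 0 := by
  rw [Ring.lie_def, mem_left.1 ha y (S.right_anti (by omega) hy), sub_self]

theorem lie_eq_zero_of_right {j k : ℤ} (h : j < k) {a y : 𝔸} (ha : a ∈ S.left j)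
    (hy : y ∈ S.right k) : ⁅y, a⁆ = 0 := by
  rw [Ring.lie_def, mem_left.1 ha y (S.right_anti (by omega) hy), sub_self]

theorem left_mono : Monotone S.left := fun _ _ h =>
  Subalgebra.centralizer_le _ _ _ (S.right_anti (by omega))

theorem bond_mem_left {j k : ℤ} (h : j < k) : S.bond j ∈ S.left k := by
  refine left_mono (show j + 1 ≤ k by omega) ?_
  have := S.bond_left j
  rwa [left, show j + 1 + 1 = j + 2 by ring]

theorem site_mem_left {j k : ℤ} (h : j ≤ k) : S.site j ∈ S.left k :=
  left_mono h (S.site_left j)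

theorem bond_mem_right {j k : ℤ} (h : k ≤ j) : S.bond j ∈ S.right k :=
  S.right_anti h (S.bond_right j)

theorem site_mem_right {j k : ℤ} (h : k ≤ j) : S.site j ∈ S.right k :=
  S.right_anti h (S.site_right j)

theorem hamBelow_mem_left (k : ℤ) : S.hamBelow k ∈ S.left k :=
  sum_mem fun j hj => by
    have hj' := (Finset.mem_filter.1 hj).2
    exact add_mem (bond_mem_left hj') (site_mem_left hj'.le)

theorem hamAbove_mem_right (k : ℤ) : S.hamAbove k ∈ S.right (k + 1) :=
  sum_mem fun j hj => by
    have hj' := (Finset.mem_filter.1 hj).2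
    exact add_mem (bond_mem_right hj') (site_mem_right hj')

theorem hamBelow_sa (k : ℤ) : IsSelfAdjoint (S.hamBelow k) :=
  isSelfAdjoint_sum _ fun j _ => (S.bond_sa j).add (S.site_sa j)

theorem ham_sa : IsSelfAdjoint S.ham :=
  isSelfAdjoint_sum _ fun j _ => (S.bond_sa j).add (S.site_sa j)

theorem hamBelow_add_one (k : ℤ) :
    S.hamBelow (k + 1) = S.hamBelow k + (S.bond k + S.site k) := by
  classical
  by_cases hk : k ∈ S.vol
  · have : (S.vol.filter (· < k + 1)) = insert k (S.vol.filter (· < k)) := by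
      ext j; simp only [Finset.mem_filter, Finset.mem_insert]
      constructor
      · rintro ⟨h1, h2⟩
        by_cases h : j = k
        · exact Or.inl h
        · exact Or.inr ⟨h1, by omega⟩
      · rintro (rfl | ⟨h1, h2⟩)
        · exact ⟨hk, by omega⟩
        · exact ⟨h1, by omega⟩
    rw [hamBelow, this, Finset.sum_insert (by simp), hamBelow, add_comm]
  · rw [S.bond_vol k hk, S.site_vol k hk, add_zero, add_zero, hamBelow, hamBelow]
    congr 1
    refine Finset.filter_congr fun j hj => ?_
    have : j ≠ k := fun h => hk (h ▸ hj)
    omega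

theorem ham_eq (k : ℤ) :
    S.ham = S.hamBelow k + (S.bond k + S.site k) + S.hamAbove k := by
  rw [← hamBelow_add_one, hamBelow, hamAbove, ham,
    ← Finset.sum_filter_add_sum_filter_not S.vol (· < k + 1)]
  congr 2
  exact Finset.filter_congr fun j _ => by omega

variable (S) in
/-- `g` bounds the growth in time of the commutators with `B` of the observables on the sites
`≤ k`. -/
def CommBound (B : 𝔸) (k : ℤ) (g : ℝ → ℝ) : Prop :=
  ∀ A ∈ S.left k, ∀ t : ℝ, 0 ≤ t → ‖⁅evolve S.ham t A, B⁆‖ ≤ ‖A‖ * g t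

/-- Crossing an arbitrary bond. The observable is first evolved backwards with the Hamiltonian to
the left of the bond, so that only the commutator with the bond itself remains. -/
theorem commBound_of_add_one {B : 𝔸} {k : ℤ} (hB : B ∈ S.right (k + 1)) {β φ γ : ℝ} (hβ : 0 ≤ β)
    (hγ : 0 ≤ γ) (hφ : ‖S.bond k‖ ≤ φ) {n m : ℕ}
    (h : S.CommBound B (k + 1)
      fun t => β * (γ * (1 + t)) ^ n * ((2 * φ * t) ^ m / m.factorial)) :
    S.CommBound B k
      fun t => β * (γ * (1 + t)) ^ n * ((2 * φ * t) ^ (m + 1) / (m + 1).factorial) := by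
  intro A hA t ht
  have hφ0 : 0 ≤ φ := (norm_nonneg _).trans hφ
  set HM : 𝔸 := S.hamBelow k + S.site k with hHM
  have hMl : HM ∈ S.left k := add_mem (hamBelow_mem_left k) (site_mem_left le_rfl)
  have hMsa : IsSelfAdjoint HM := (hamBelow_sa k).add (S.site_sa k)
  set a : ℝ → 𝔸 := fun s => evolve (-HM) s (evolve HM t A) with ha
  have hal : ∀ s, a s ∈ S.left k := fun s =>
    evolve_mem_centralizer (neg_mem hMl) (evolve_mem_centralizer hMl hA t) s
  have han : ∀ s, ‖a s‖ = ‖A‖ := fun s => by rw [ha, norm_evolve hMsa.neg, norm_evolve hMsa]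
  have hat : a t = A := evolve_neg_evolve HM t A
  have hder : ∀ s, HasDerivAt a
      (Complex.I • ⁅S.bond k, a s⁆ - Complex.I • ⁅S.ham, a s⁆) s := by
    intro s
    refine (hasDerivAt_evolve_const (-HM) _ s).congr_deriv ?_
    have h1 : ⁅S.hamAbove k, a s⁆ = 0 :=
      lie_eq_zero_of_right (lt_add_one k) (hal s) (hamAbove_mem_right k)
    have h2 : ⁅S.ham, a s⁆ = ⁅HM, a s⁆ + ⁅S.bond k, a s⁆ := by
      rw [ham_eq k, hHM]
      rw [Ring.lie_def] at h1
      simp only [Ring.lie_def]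
      linear_combination (norm := noncomm_ring) h1
    have h3 : ⁅-HM, a s⁆ = -⁅HM, a s⁆ := by
      simp only [Ring.lie_def]
      noncomm_ring
    change Complex.I • ⁅-HM, a s⁆ = _
    rw [h2, h3, smul_add, smul_neg]
    abel
  have key := norm_lie_evolve_le (H := S.ham) (B := B) ht hder
    (lie_eq_zero_of_left (lt_add_one k) (hal 0) hB)
    (g := fun s => ‖A‖ * (β * (γ * (1 + t)) ^ n * ((2 * φ * s) ^ (m + 1) / (m + 1).factorial)))
    (g' := fun s => (2 * φ * ‖A‖) * (β * (γ * (1 + t)) ^ n * ((2 * φ * s) ^ m / m.factorial)))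
    (by simp) ?_ ?_
  · rwa [hat] at key
  · intro s
    have h1 : HasDerivAt (fun s : ℝ => (2 * φ * s) ^ (m + 1))
        (((m + 1 : ℕ) : ℝ) * (2 * φ * s) ^ m * (2 * φ * 1)) s :=
      ((hasDerivAt_id s).const_mul (2 * φ)).pow (m + 1)
    refine ((((h1.div_const _).const_mul _)).const_mul _).congr_deriv ?_
    rw [Nat.factorial_succ]
    push_cast
    field_simp
  · intro s hs hst
    have hmem : Complex.I • ⁅S.bond k, a s⁆ ∈ S.left (k + 1) :=
      Subalgebra.smul_mem _ (lie_mem_subalgebra (bond_mem_left (lt_add_one k))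
        (left_mono (by omega) (hal s))) _
    refine (h _ hmem s hs).trans ?_
    have hn : ‖Complex.I • ⁅S.bond k, a s⁆‖ ≤ 2 * φ * ‖A‖ := by
      rw [norm_smul, Complex.norm_I, one_mul]
      refine (norm_lie_le _ _).trans ?_
      rw [han]
      gcongr
    beta_reduce
    gcongr

end Chain

/-! ### Pinching and the off-diagonal equation -/

section Pinching

variable {𝔸 ι : Type*} [CStarAlgebra 𝔸] [Fintype ι]

/-- The part `∑_i P_i X P_i` of `X` that is block diagonal with respect to the `P_i`. -/
def pinch (P : ι → 𝔸) (X : 𝔸) : 𝔸 := ∑ i, P i * X * P i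

/-- The solution `S` of `[S, ∑_i v_i P_i] = X - pinch P X` for spectral projections `P_i` with
eigenvalues `v_i`. The terms with `i = j` vanish since `0⁻¹ = 0`. -/
noncomputable def commSolution (P : ι → 𝔸) (v : ι → ℝ) (X : 𝔸) : 𝔸 :=
  ∑ i, ∑ j, (((v j - v i)⁻¹ : ℝ) : ℂ) • (P i * X * P j)

variable {P : ι → 𝔸} {v : ι → ℝ}

theorem pinch_mem {S : Subalgebra ℂ 𝔸} (hP : ∀ i, P i ∈ S) {X : 𝔸} (hX : X ∈ S) :
    pinch P X ∈ S :=
  sum_mem fun i _ => mul_mem (mul_mem (hP i) hX) (hP i)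

theorem commSolution_mem {S : Subalgebra ℂ 𝔸} (hP : ∀ i, P i ∈ S) {X : 𝔸} (hX : X ∈ S) :
    commSolution P v X ∈ S :=
  sum_mem fun i _ => sum_mem fun j _ =>
    Subalgebra.smul_mem _ (mul_mem (mul_mem (hP i) hX) (hP j)) _

theorem pinch_add (X Y : 𝔸) : pinch P (X + Y) = pinch P X + pinch P Y := by
  simp [pinch, mul_add, add_mul, Finset.sum_add_distrib]

theorem norm_mul_mul_le_of_norm_le_one {p q : 𝔸} (hp : ‖p‖ ≤ 1) (hq : ‖q‖ ≤ 1) (X : 𝔸) :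
    ‖p * X * q‖ ≤ ‖X‖ := by
  calc ‖p * X * q‖ ≤ ‖p‖ * ‖X‖ * ‖q‖ :=
        (norm_mul_le _ _).trans (mul_le_mul_of_nonneg_right (norm_mul_le _ _) (norm_nonneg _))
    _ ≤ 1 * ‖X‖ * 1 := by gcongr
    _ = ‖X‖ := by ring

theorem norm_pinch_le (hP : ∀ i, ‖P i‖ ≤ 1) (X : 𝔸) :
    ‖pinch P X‖ ≤ Fintype.card ι * ‖X‖ := by
  refine (norm_sum_le_of_le _ fun i _ => norm_mul_mul_le_of_norm_le_one (hP i) (hP i) X).trans ?_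
  simp

theorem norm_commSolution_le (hP : ∀ i, ‖P i‖ ≤ 1) {δ : ℝ} (hδ : 0 < δ)
    (hgap : ∀ i j, i ≠ j → δ ≤ |v i - v j|) (X : 𝔸) :
    ‖commSolution P v X‖ ≤ Fintype.card ι ^ 2 * (δ⁻¹ * ‖X‖) := by
  have h : ∀ i j, ‖(((v j - v i)⁻¹ : ℝ) : ℂ) • (P i * X * P j)‖ ≤ δ⁻¹ * ‖X‖ := by
    intro i j
    rw [norm_smul, Complex.norm_real, norm_inv, Real.norm_eq_abs]
    have h1 : |v j - v i|⁻¹ ≤ δ⁻¹ := by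
      by_cases hij : j = i
      · simp [hij, hδ.le]
      · exact inv_anti₀ hδ (hgap j i hij)
    exact mul_le_mul h1 (norm_mul_mul_le_of_norm_le_one (hP i) (hP j) X) (norm_nonneg _)
      (by positivity)
  refine (norm_sum_le_of_le _ fun i _ => norm_sum_le_of_le _ fun j _ => h i j).trans ?_
  simp only [Finset.sum_const, Finset.card_univ, nsmul_eq_mul]
  rw [sq, mul_assoc]

variable [DecidableEq ι]

theorem commute_pinch (hmul : ∀ i j, P i * P j = if i = j then P i else 0) (X : 𝔸) (k : ι) :
    P k * pinch P X = pinch P X * P k := by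
  simp only [pinch, Finset.mul_sum, Finset.sum_mul]
  refine Finset.sum_congr rfl fun i _ => ?_
  rw [← mul_assoc, ← mul_assoc, hmul, mul_assoc (P i * X), hmul]
  by_cases h : i = k
  · subst h; simp
  · simp [h, Ne.symm h]

theorem mul_spectral (hmul : ∀ i j, P i * P j = if i = j then P i else 0) (k : ι) :
    P k * ∑ i, (v i : ℂ) • P i = (v k : ℂ) • P k := by
  simp [Finset.mul_sum, hmul]

theorem spectral_mul (hmul : ∀ i j, P i * P j = if i = j then P i else 0) (k : ι) :
    (∑ i, (v i : ℂ) • P i) * P k = (v k : ℂ) • P k := by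
  simp only [Finset.sum_mul, smul_mul_assoc, hmul]
  rw [Finset.sum_eq_single k (fun i _ h => by simp [h]) (by simp)]
  simp

theorem lie_commSolution (hmul : ∀ i j, P i * P j = if i = j then P i else 0)
    (hsum : ∑ i, P i = 1) (hv : Function.Injective v) (X : 𝔸) :
    ⁅commSolution P v X, ∑ i, (v i : ℂ) • P i⁆ = X - pinch P X := by
  have hX : X = ∑ i, ∑ j, P i * X * P j := by
    simp only [← Finset.mul_sum, ← Finset.sum_mul, hsum, one_mul, mul_one]
  have hp : pinch P X = ∑ i, ∑ j, if i = j then P i * X * P j else 0 := by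
    simp [pinch]
  rw [Ring.lie_def, commSolution, Finset.sum_mul, Finset.mul_sum, hp]
  conv_rhs => enter [1]; rw [hX]
  rw [← Finset.sum_sub_distrib, ← Finset.sum_sub_distrib]
  refine Finset.sum_congr rfl fun i _ => ?_
  rw [Finset.sum_mul, Finset.mul_sum, ← Finset.sum_sub_distrib, ← Finset.sum_sub_distrib]
  refine Finset.sum_congr rfl fun j _ => ?_
  rw [smul_mul_assoc, mul_smul_comm, mul_assoc (P i * X), mul_spectral hmul, ← mul_assoc,
    ← mul_assoc, spectral_mul hmul, mul_smul_comm, smul_mul_assoc, smul_mul_assoc, smul_smul,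
    smul_smul, ← sub_smul]
  by_cases h : i = j
  · subst h; simp
  · have h1 : v j - v i ≠ 0 := sub_ne_zero.2 fun h2 => h (hv h2.symm)
    have h2 : ((v j : ℂ) - v i) ≠ 0 := by exact_mod_cast h1
    have h3 : (((v j - v i)⁻¹ : ℝ) : ℂ) * (v j : ℂ) - (((v j - v i)⁻¹ : ℝ) : ℂ) * (v i : ℂ) = 1 := by
      push_cast
      rw [← mul_sub, inv_mul_cancel₀ h2]
    rw [h3, one_smul, if_neg h, sub_zero]

end Pinching

/-! ### Crossing an impurity -/

/-- The algebra behind the corrected observable `a + [T, a]`. -/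
theorem corrected_derivative {R : Type*} [Ring R] {H HM O T F a : R}
    (hH : ⁅H, a⁆ = ⁅HM, a⁆ + ⁅O, a⁆) (hT : ⁅T, H⁆ = O + ⁅T, F⁆) :
    -⁅HM, a⁆ + ⁅T, -⁅HM, a⁆⁆ = (⁅T, ⁅O, a⁆⁆ - ⁅⁅T, F⁆, a⁆) - ⁅H, a + ⁅T, a⁆⁆ := by
  have h1 : ⁅HM, a⁆ = ⁅H, a⁆ - ⁅O, a⁆ := by rw [hH, add_sub_cancel_right]
  rw [h1]
  have h2 : ⁅⁅T, H⁆, a⁆ = ⁅O + ⁅T, F⁆, a⁆ := by rw [hT]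
  simp only [Ring.lie_def] at *
  linear_combination (norm := noncomm_ring) -h2

namespace Chain

variable {𝔸 ι : Type*} [CStarAlgebra 𝔸] [Fintype ι] [DecidableEq ι]

/-- The chain has an impurity at the site `x`: the on-site term is `λ ∑_i v_i P_i` with spectral
projections `P_i` of rank one on the site and eigenvalues `v_i` at mutual distance at least `δ`, and
the neighbouring sites carry no on-site term. That the `P_i` have rank one enters through `diag`:
the pinched bond to the right of `x` belongs to the algebra generated by the `P_i` and the
observables on the sites `> x`. -/
structure IsImpurity (S : Chain 𝔸) (x : ℤ) (P : ι → 𝔸) (v : ι → ℝ) (lam δ : ℝ) : Prop where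
  sa : ∀ i, IsSelfAdjoint (P i)
  mul : ∀ i j, P i * P j = if i = j then P i else 0
  sum_eq_one : ∑ i, P i = 1
  norm_le : ∀ i, ‖P i‖ ≤ 1
  right : ∀ i, P i ∈ S.right x
  left : ∀ i, P i ∈ S.left x
  site_eq : S.site x = (lam : ℂ) • ∑ i, (v i : ℂ) • P i
  gap : ∀ i j, i ≠ j → δ ≤ |v i - v j|
  diag : ∀ a ∈ S.left x, (∀ i, P i * a = a * P i) → pinch P (S.bond x) * a = a * pinch P (S.bond x)
  site_prev : S.site (x - 1) = 0
  site_next : S.site (x + 1) = 0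

/-- The constant in the estimate for crossing an impurity. -/
noncomputable def crossConst (n : ℕ) (δ φ : ℝ) : ℝ :=
  (n ^ 2 * (δ⁻¹ * (2 * φ))) * (2 + 16 * φ + 4 * ((n + 1) * (2 * φ)))

theorem crossConst_nonneg (n : ℕ) {δ φ : ℝ} (hδ : 0 < δ) (hφ : 0 ≤ φ) :
    0 ≤ crossConst n δ φ := by
  unfold crossConst; positivity

variable {S : Chain 𝔸} {x : ℤ} {P : ι → 𝔸} {v : ι → ℝ} {lam δ : ℝ}

/-- Crossing an impurity gains a factor `1/λ`. With the bonds at `x` replaced by their pinchings, the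
observables on the sites `< x` stay in the algebra generated by the sites `< x` and the `P_i`, and
never get past `x`. The remaining, off-diagonal part of the bonds equals `[T, λV]` for some
`T = O(1/λ)`, so that replacing `a` by `a + [T, a]` cancels its contribution to first order. -/
theorem commBound_of_impurity (hx : S.IsImpurity x P v lam δ) (hlam : lam ≠ 0) (hδ : 0 < δ)
    {φ : ℝ} (hφ : ∀ j, ‖S.bond j‖ ≤ φ) {B : 𝔸} (hB : B ∈ S.right (x + 2)) {g : ℝ → ℝ}
    (hg0 : ∀ t, 0 ≤ t → 0 ≤ g t) (hg : MonotoneOn g (Set.Ici 0)) (h : S.CommBound B (x + 2) g) :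
    S.CommBound B (x - 1)
      fun t => crossConst (Fintype.card ι) δ φ / |lam| * (1 + t) * g t := by
  intro A hA t ht
  have hφ0 : 0 ≤ φ := (norm_nonneg _).trans (hφ x)
  set n := Fintype.card ι with hn
  set X : 𝔸 := S.bond (x - 1) + S.bond x with hX
  set F : 𝔸 := S.bond (x - 2) + X + S.bond (x + 1) with hF
  set O : 𝔸 := X - pinch P X with hO
  set Q : 𝔸 := commSolution P v X with hQ
  set T : 𝔸 := ((lam⁻¹ : ℝ) : ℂ) • Q with hT
  set HM : 𝔸 := S.hamBelow (x - 1) + pinch P (S.bond (x - 1)) + S.site x with hHM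
  have hPr : ∀ i, P i ∈ S.right (x - 1) := fun i => S.right_anti (by omega) (hx.right i)
  have hXr : X ∈ S.right (x - 1) := add_mem (bond_mem_right le_rfl) (bond_mem_right (by omega))
  have hXl : X ∈ S.left (x + 1) := add_mem (bond_mem_left (by omega)) (bond_mem_left (by omega))
  have hPl : ∀ i, P i ∈ S.left (x + 1) := fun i => left_mono (by omega) (hx.left i)
  have hTr : T ∈ S.right (x - 1) := Subalgebra.smul_mem _ (commSolution_mem hPr hXr) _
  have hTl : T ∈ S.left (x + 1) := Subalgebra.smul_mem _ (commSolution_mem hPl hXl) _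
  have hOl : O ∈ S.left (x + 1) := sub_mem hXl (pinch_mem hPl hXl)
  have hFl : F ∈ S.left (x + 2) :=
    add_mem (add_mem (bond_mem_left (by omega)) (left_mono (by omega) hXl))
      (bond_mem_left (by omega))
  have hXn : ‖X‖ ≤ 2 * φ := (norm_add_le _ _).trans (by linarith [hφ (x - 1), hφ x])
  have hFn : ‖F‖ ≤ 4 * φ := by
    refine (norm_add_le _ _).trans ?_
    linarith [norm_add_le (S.bond (x - 2)) X, hφ (x - 2), hφ (x + 1)]
  have hOn : ‖O‖ ≤ (n + 1) * (2 * φ) := by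
    refine (norm_sub_le _ _).trans ?_
    have h1 := norm_pinch_le hx.norm_le X
    have h2 : (n : ℝ) * ‖X‖ ≤ n * (2 * φ) := by gcongr
    linarith
  have hTn : ‖T‖ ≤ n ^ 2 * (δ⁻¹ * (2 * φ)) / |lam| := by
    rw [hT, norm_smul, Complex.norm_real, norm_inv, Real.norm_eq_abs, div_eq_inv_mul]
    refine mul_le_mul_of_nonneg_left ?_ (by positivity)
    refine (norm_commSolution_le hx.norm_le hδ hx.gap X).trans ?_
    gcongr
  -- the algebra `N` that the diagonal dynamics does not leave
  set N : Subalgebra ℂ 𝔸 :=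
    Subalgebra.centralizer ℂ ((S.right (x + 1) : Set 𝔸) ∪ Set.range P) with hN
  have hNmem : ∀ a, a ∈ N ↔ a ∈ S.left x ∧ ∀ i, P i * a = a * P i := by
    intro a
    rw [mem_left, hN, Subalgebra.mem_centralizer_iff]
    constructor
    · exact fun h1 => ⟨fun y hy => h1 y (Or.inl hy), fun i => h1 _ (Or.inr ⟨i, rfl⟩)⟩
    · rintro ⟨h1, h2⟩ y (hy | ⟨i, rfl⟩)
      exacts [h1 y hy, h2 i]
  have hleftN : ∀ a ∈ S.left (x - 1), a ∈ N := fun a ha =>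
    (hNmem a).2 ⟨left_mono (by omega) ha, fun i =>
      mem_left.1 ha _ (by rw [sub_add_cancel]; exact hx.right i)⟩
  have hMN : HM ∈ N := by
    refine add_mem (add_mem (hleftN _ (hamBelow_mem_left _)) ((hNmem _).2 ⟨?_, ?_⟩))
      ((hNmem _).2 ⟨site_mem_left le_rfl, fun i => ?_⟩)
    · exact pinch_mem hx.left (bond_mem_left (by omega))
    · exact commute_pinch hx.mul _
    · rw [hx.site_eq, mul_smul_comm, smul_mul_assoc, mul_spectral hx.mul, spectral_mul hx.mul]
  have hMsa : IsSelfAdjoint HM := by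
    refine ((hamBelow_sa _).add (isSelfAdjoint_sum _ fun i _ => ?_)).add (S.site_sa x)
    have h1 := (S.bond_sa (x - 1)).conjugate (P i)
    rwa [(hx.sa i).star_eq] at h1
  set a : ℝ → 𝔸 := fun s => evolve (-HM) s (evolve HM t A) with ha
  have haN : ∀ s, a s ∈ N := fun s =>
    evolve_mem_centralizer (neg_mem hMN) (evolve_mem_centralizer hMN (hleftN A hA) t) s
  have hal : ∀ s, a s ∈ S.left x := fun s => ((hNmem _).1 (haN s)).1
  have han : ∀ s, ‖a s‖ = ‖A‖ := fun s => by rw [ha, norm_evolve hMsa.neg, norm_evolve hMsa]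
  have hat : a t = A := evolve_neg_evolve HM t A
  have hham : S.ham = S.hamBelow (x - 1) + X + S.site x + S.bond (x + 1) + S.hamAbove (x + 1) := by
    have h1 := hamBelow_add_one (S := S) (x - 1)
    rw [sub_add_cancel] at h1
    rw [ham_eq (x + 1), hamBelow_add_one, h1, hx.site_prev, hx.site_next, hX]
    abel
  -- on `N`, only the off-diagonal part of the bonds at `x` is left of `ham - HM`
  have hH : ∀ s, ⁅S.ham, a s⁆ = ⁅HM, a s⁆ + ⁅O, a s⁆ := by
    intro s
    have h1 : ⁅S.hamAbove (x + 1), a s⁆ = 0 :=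
      lie_eq_zero_of_right (by omega) (hal s) (hamAbove_mem_right (x + 1))
    have h2 : ⁅S.bond (x + 1), a s⁆ = 0 :=
      lie_eq_zero_of_right (lt_add_one x) (hal s) (S.bond_right _)
    have h3 := hx.diag _ (hal s) ((hNmem _).1 (haN s)).2
    rw [hham, hO, hHM, hX, pinch_add]
    simp only [Ring.lie_def] at *
    linear_combination (norm := noncomm_ring) h1 + h2 + h3
  -- `T` is chosen such that `[T, λV] = O`; otherwise it only meets the four bonds in `F`
  have hTH : ⁅T, S.ham⁆ = O + ⁅T, F⁆ := by
    have h1 : ⁅T, S.hamAbove (x + 1)⁆ = 0 :=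
      lie_eq_zero_of_left (by omega) hTl (hamAbove_mem_right (x + 1))
    have h2 : ⁅T, S.hamBelow (x - 2)⁆ = 0 :=
      lie_eq_zero_of_right (by omega) (hamBelow_mem_left (x - 2)) hTr
    have h3 : ⁅T, S.site (x - 2)⁆ = 0 :=
      lie_eq_zero_of_right (show x - 2 < x - 1 by omega) (site_mem_left le_rfl) hTr
    have h4 : ⁅T, S.site x⁆ = O := by
      have hv : Function.Injective v := fun i j hij => by
        by_contra hne
        have := hx.gap i j hne
        rw [hij, sub_self, abs_zero] at this
        linarith
      have h5 : ⁅Q, ∑ i, (v i : ℂ) • P i⁆ = O := lie_commSolution hx.mul hx.sum_eq_one hv X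
      rw [hx.site_eq, hT, ← h5, Ring.lie_def, Ring.lie_def, smul_mul_smul_comm,
        smul_mul_smul_comm, ← Complex.ofReal_mul, ← Complex.ofReal_mul, inv_mul_cancel₀ hlam,
        mul_inv_cancel₀ hlam, Complex.ofReal_one, one_smul, one_smul]
    have h5 := hamBelow_add_one (S := S) (x - 2)
    rw [show x - 2 + 1 = x - 1 by ring] at h5
    rw [hham, hF, h5]
    simp only [Ring.lie_def] at *
    linear_combination (norm := noncomm_ring) h1 + h2 + h3 + h4
  set e : ℝ → 𝔸 := fun s => Complex.I • (⁅T, ⁅O, a s⁆⁆ - ⁅⁅T, F⁆, a s⁆) with he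
  set c : ℝ → 𝔸 := fun s => a s + ⁅T, a s⁆ with hc
  have hder : ∀ s, HasDerivAt c (e s - Complex.I • ⁅S.ham, c s⁆) s := by
    intro s
    have h1 : HasDerivAt a (Complex.I • ⁅-HM, a s⁆) s := hasDerivAt_evolve_const (-HM) _ s
    have h2 : HasDerivAt (fun s => ⁅T, a s⁆) ⁅T, Complex.I • ⁅-HM, a s⁆⁆ s := by
      simp only [Ring.lie_def T]
      exact (h1.const_mul T).sub (h1.mul_const T)
    refine (h1.add h2).congr_deriv ?_
    have h3 := corrected_derivative (hH s) hTH
    have h4 : ⁅-HM, a s⁆ = -⁅HM, a s⁆ := by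
      simp only [Ring.lie_def]
      noncomm_ring
    have h5 : ∀ Y : 𝔸, ⁅T, Complex.I • Y⁆ = Complex.I • ⁅T, Y⁆ := fun Y => by
      rw [Ring.lie_def, Ring.lie_def, mul_smul_comm, smul_mul_assoc _ Y T, smul_sub]
    rw [h4, h5, ← smul_add, h3, smul_sub]
  have hcl : ∀ s, c s ∈ S.left (x + 1) := fun s =>
    add_mem (left_mono (by omega) (hal s)) (lie_mem_subalgebra hTl (left_mono (by omega) (hal s)))
  have hel : ∀ s, e s ∈ S.left (x + 2) := by
    intro s
    have h1 : a s ∈ S.left (x + 2) := left_mono (by omega) (hal s)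
    have h2 : T ∈ S.left (x + 2) := left_mono (by omega) hTl
    exact Subalgebra.smul_mem _ (sub_mem
      (lie_mem_subalgebra h2 (lie_mem_subalgebra (left_mono (by omega) hOl) h1))
      (lie_mem_subalgebra (lie_mem_subalgebra h2 hFl) h1)) _
  set s₀ : ℝ := n ^ 2 * (δ⁻¹ * (2 * φ)) / |lam| with hs₀
  have hs₀0 : 0 ≤ s₀ := by positivity
  have hen : ∀ s, ‖e s‖ ≤ s₀ * (16 * φ + 4 * ((n + 1) * (2 * φ))) * ‖A‖ := by
    intro s
    have h1 : ‖⁅T, ⁅O, a s⁆⁆‖ ≤ 2 * s₀ * (2 * ((n + 1) * (2 * φ)) * ‖A‖) := by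
      refine (norm_lie_le _ _).trans ?_
      have : ‖⁅O, a s⁆‖ ≤ 2 * ((n + 1) * (2 * φ)) * ‖A‖ := by
        refine (norm_lie_le _ _).trans ?_
        rw [han]
        gcongr
      gcongr
    have h2 : ‖⁅⁅T, F⁆, a s⁆‖ ≤ 2 * (2 * s₀ * (4 * φ)) * ‖A‖ := by
      refine (norm_lie_le _ _).trans ?_
      have : ‖⁅T, F⁆‖ ≤ 2 * s₀ * (4 * φ) := by
        refine (norm_lie_le _ _).trans ?_
        gcongr
      rw [han]
      gcongr
    rw [he, norm_smul, Complex.norm_I, one_mul]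
    refine (norm_sub_le _ _).trans ((add_le_add h1 h2).trans (le_of_eq (by ring)))
  -- the boundary term at time `0` vanishes since `c 0` is supported on the sites `≤ x + 1`
  have key := norm_lie_evolve_le (H := S.ham) (B := B) ht hder
    (lie_eq_zero_of_left (by omega) (hcl 0) hB)
    (g := fun s => s₀ * (16 * φ + 4 * ((n + 1) * (2 * φ))) * ‖A‖ * g t * s)
    (g' := fun s => s₀ * (16 * φ + 4 * ((n + 1) * (2 * φ))) * ‖A‖ * g t * 1)
    (by simp) (fun s => (hasDerivAt_id s).const_mul _) ?_
  · have h1 : ⁅evolve S.ham t A, B⁆ = ⁅evolve S.ham t (c t), B⁆ - ⁅evolve S.ham t ⁅T, A⁆, B⁆ := by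
      rw [hc]
      beta_reduce
      rw [hat, evolve_add]
      simp only [Ring.lie_def]
      noncomm_ring
    have h2 : ‖⁅evolve S.ham t ⁅T, A⁆, B⁆‖ ≤ 2 * s₀ * ‖A‖ * g t := by
      refine (h _ (lie_mem_subalgebra (left_mono (by omega) hTl) (left_mono (by omega) hA))
        t ht).trans ?_
      refine mul_le_mul_of_nonneg_right ?_ (hg0 t ht)
      refine (norm_lie_le _ _).trans ?_
      gcongr
    rw [h1]
    refine (norm_sub_le _ _).trans ((add_le_add key h2).trans ?_)
    have h3 : crossConst n δ φ / |lam| = s₀ * (2 + 16 * φ + 4 * ((n + 1) * (2 * φ))) := by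
      rw [crossConst, hs₀]; ring
    beta_reduce
    rw [h3]
    have h4 : 0 ≤ s₀ * ‖A‖ * g t := mul_nonneg (by positivity) (hg0 t ht)
    have h5 : 0 ≤ s₀ * ‖A‖ * g t * (16 * φ + 4 * ((n + 1) * (2 * φ))) :=
      mul_nonneg h4 (by positivity)
    have h6 : 0 ≤ s₀ * ‖A‖ * g t * t := mul_nonneg h4 ht
    linarith
  · intro s hs hst
    refine (h _ (hel s) s hs).trans ?_
    rw [mul_one]
    exact mul_le_mul (hen s) (hg hs ht hst.le) (hg0 s hs) (by positivity)

end Chain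

/-! ### Iteration over the sites -/

namespace Chain

variable {𝔸 ι : Type*} [CStarAlgebra 𝔸] [Fintype ι] [DecidableEq ι] {S : Chain 𝔸}

theorem commBound_trivial (B : 𝔸) (k : ℤ) : S.CommBound B k fun _ => 2 * ‖B‖ := by
  intro A _ t _
  refine (norm_lie_le _ _).trans (le_of_eq ?_)
  rw [norm_evolve ham_sa]
  ring

/-- Lieb-Robinson bound at distance `r` from the support of `B`, in the presence of impurities: each
impurity uses up three sites and contributes a factor `γ (1 + t)`, and the remaining `m` sites
contribute as in a chain without impurities. -/
theorem exists_commBound {G : Finset ℤ} {b : ℤ} {P : ℤ → ι → 𝔸} {v : ι → ℝ} {lam δ φ : ℝ}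
    (hlam : lam ≠ 0) (hδ : 0 < δ) (hφ : ∀ j, ‖S.bond j‖ ≤ φ) (hGb : ∀ x ∈ G, x ≤ b - 3)
    (hsep : ∀ x ∈ G, ∀ y ∈ G, x < y → x + 3 ≤ y)
    (himp : ∀ x ∈ G, S.IsImpurity x (P x) v lam δ) {B : 𝔸} (hB : B ∈ S.right b) (r : ℕ)
    (hr : 1 ≤ r) :
    ∃ m : ℕ, 1 ≤ m ∧ m + 3 * (G.filter (b - r < ·)).card = r ∧
      S.CommBound B (b - r) fun t =>
        2 * ‖B‖ * (crossConst (Fintype.card ι) δ φ / |lam| * (1 + t)) ^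
          (G.filter (b - r < ·)).card * ((2 * φ * t) ^ m / m.factorial) := by
  have hφ0 : 0 ≤ φ := (norm_nonneg _).trans (hφ 0)
  set γ := crossConst (Fintype.card ι) δ φ / |lam| with hγ
  have hγ0 : 0 ≤ γ := div_nonneg (crossConst_nonneg _ hδ hφ0) (abs_nonneg _)
  have hβ : 0 ≤ 2 * ‖B‖ := by positivity
  induction r using Nat.strong_induction_on with
  | _ r ih =>
  have hBr : ∀ k : ℤ, k ≤ b → B ∈ S.right k := fun k hk => S.right_anti hk hB
  by_cases hmem : b - r + 1 ∈ G
  · -- the next site is an impurity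
    have hle := hGb _ hmem
    obtain ⟨m, hm1, hm, hbd⟩ := ih (r - 3) (by omega) (by omega)
    have hk : b - ((r - 3 : ℕ) : ℤ) = b - r + 1 + 2 := by
      rw [Nat.cast_sub (by omega)]; push_cast; ring
    rw [hk] at hm hbd
    have hfil : G.filter (b - r < ·) = insert (b - r + 1) (G.filter (b - r + 1 + 2 < ·)) := by
      ext y
      simp only [Finset.mem_filter, Finset.mem_insert]
      constructor
      · rintro ⟨h1, h2⟩
        by_cases hy : y = b - r + 1
        · exact Or.inl hy
        · have := hsep _ hmem y h1 (by omega)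
          exact Or.inr ⟨h1, by omega⟩
      · rintro (rfl | ⟨h1, h2⟩)
        · exact ⟨hmem, by omega⟩
        · exact ⟨h1, by omega⟩
    have hcard : (G.filter (b - r < ·)).card = (G.filter (b - r + 1 + 2 < ·)).card + 1 := by
      rw [hfil, Finset.card_insert_of_notMem fun h => by
        have := (Finset.mem_filter.1 h).2
        omega]
    refine ⟨m, hm1, by omega, ?_⟩
    have hstep := commBound_of_impurity (himp _ hmem) hlam hδ hφ (hBr _ (by omega))
      (fun t ht => ?_) (fun s hs t ht hst => ?_) hbd
    · rw [show b - (r : ℤ) + 1 - 1 = b - r by ring] at hstep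
      intro A hA t ht
      refine (hstep A hA t ht).trans (le_of_eq ?_)
      beta_reduce
      rw [hcard, ← hγ]
      ring
    · have : 0 ≤ 1 + t := by linarith
      positivity
    · have hs' : 0 ≤ s := hs
      have ht' : 0 ≤ 1 + t := by linarith
      have hs'' : 0 ≤ 1 + s := by linarith
      gcongr
  · have hfil : G.filter (b - r < ·) = G.filter (b - r + 1 < ·) := by
      refine Finset.filter_congr fun y hy => ?_
      have : y ≠ b - r + 1 := fun h => hmem (h ▸ hy)
      omega
    rw [hfil]
    obtain rfl | hr2 : r = 1 ∨ 2 ≤ r := by omega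
    · have hempty : G.filter (b - (1 : ℕ) + 1 < ·) = ∅ := by
        refine Finset.filter_eq_empty_iff.2 fun y hy => ?_
        have := hGb y hy
        push_cast
        omega
      refine ⟨1, le_rfl, by rw [hempty]; simp, ?_⟩
      rw [hempty]
      refine commBound_of_add_one (m := 0) (hBr _ (by push_cast; omega)) hβ hγ0 (hφ _) ?_
      simpa using commBound_trivial B _
    · obtain ⟨m, hm1, hm, hbd⟩ := ih (r - 1) (by omega) (by omega)
      have hk : b - ((r - 1 : ℕ) : ℤ) = b - r + 1 := by
        rw [Nat.cast_sub (by omega)]; push_cast; ring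
      rw [hk] at hm hbd
      exact ⟨m + 1, by omega, by omega,
        commBound_of_add_one (hBr _ (by omega)) hβ hγ0 (hφ _) hbd⟩

end Chain

/-- A term of the exponential series of order at least one, with exponential decay extracted. -/
theorem two_mul_pow_div_factorial_le {m : ℕ} (hm : 1 ≤ m) {μ φ t w : ℝ} (hφ : 0 ≤ φ)
    (ht : 0 ≤ t) (hw : 8 * Real.exp μ * φ ≤ w) :
    2 * ((2 * φ * t) ^ m / m.factorial) ≤ Real.exp (w * t) * Real.exp (-μ * m) := by
  have h1 : (8 * Real.exp μ * φ * t) ^ m / m.factorial ≤ Real.exp (8 * Real.exp μ * φ * t) :=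
    Real.pow_div_factorial_le_exp _ (by positivity) m
  have h2 : (8 * Real.exp μ * φ * t) ^ m = 4 ^ m * Real.exp (μ * m) * (2 * φ * t) ^ m := by
    rw [mul_comm μ, Real.exp_nat_mul, ← mul_pow, ← mul_pow]
    congr 1
    ring
  have h3 : (2 : ℝ) ≤ 4 ^ m :=
    le_trans (by norm_num) (pow_le_pow_right₀ (by norm_num : (1 : ℝ) ≤ 4) hm)
  have h4 : Real.exp (8 * Real.exp μ * φ * t) ≤ Real.exp (w * t) :=
    Real.exp_le_exp.2 (mul_le_mul_of_nonneg_right hw ht)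
  have h5 : 0 ≤ (2 * φ * t) ^ m / (m.factorial : ℝ) := by positivity
  calc 2 * ((2 * φ * t) ^ m / m.factorial)
      ≤ 4 ^ m * ((2 * φ * t) ^ m / m.factorial) := by gcongr
    _ = (8 * Real.exp μ * φ * t) ^ m / m.factorial * Real.exp (-μ * m) := by
        have h6 : Real.exp (μ * m) * Real.exp (-μ * m) = 1 := by
          rw [← Real.exp_add]; simp
        rw [h2]
        linear_combination (-(4 ^ m * ((2 * φ * t) ^ m / m.factorial))) * h6
    _ ≤ Real.exp (w * t) * Real.exp (-μ * m) := by
        gcongr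
        exact h1.trans h4

/-- The constant `K` of the impurity factor `K μ d (1 + w t) / |λ|`, for a bond norm `φ`, an
exponent `w` and a crossing constant `C`. -/
noncomputable def impurityConst (C μ w : ℝ) : ℝ :=
  C * Real.exp (3 * μ) * (1 + w⁻¹) / μ + 1

/-- The product of the factors from the impurities and from the other sites is at most the factor
of the Lieb-Robinson bound. If `w = 0`, then `φ = 0` and the left-hand side vanishes. -/
theorem impurity_factor_le {m n r : ℕ} (hm : 1 ≤ m) (hmr : m + 3 * n = r)
    {μ φ t w C l : ℝ} (hμ : 0 < μ) (hφ : 0 ≤ φ) (ht : 0 ≤ t) (hw : 8 * Real.exp μ * φ ≤ w)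
    (hC : 0 ≤ C) (hl : 0 < l) :
    2 * ((C / l * (1 + t)) ^ n * ((2 * φ * t) ^ m / m.factorial)) ≤
      (impurityConst C μ w * (μ * r * (1 + w * t) / l)) ^ n * Real.exp (w * t) *
        Real.exp (-μ * r) := by
  have hw0 : 0 ≤ w := le_trans (by positivity) hw
  have hK : 0 < impurityConst C μ w := by unfold impurityConst; positivity
  rcases hw0.eq_or_lt with hw1 | hw1
  · have : φ = 0 := by
      have h1 : 0 < 8 * Real.exp μ := by positivity
      nlinarith
    rw [this, mul_zero, zero_mul, zero_pow (by omega), zero_div, mul_zero, mul_zero]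
    positivity
  have hr1 : (1 : ℝ) ≤ r := by exact_mod_cast (by omega : 1 ≤ r)
  have h1 : C / l * (1 + t) * Real.exp (3 * μ) ≤
      impurityConst C μ w * (μ * r * (1 + w * t) / l) := by
    have h2 : (1 + t) ≤ (1 + w⁻¹) * (1 + w * t) := by
      have h3 : w⁻¹ * w = 1 := inv_mul_cancel₀ hw1.ne'
      have h4 : (1 + w⁻¹) * (1 + w * t) = 1 + t + (w⁻¹ + w * t) := by
        linear_combination t * h3
      rw [h4]
      have : 0 ≤ w⁻¹ + w * t := by positivity
      linarith
    calc C / l * (1 + t) * Real.exp (3 * μ)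
        ≤ C / l * ((1 + w⁻¹) * (1 + w * t)) * Real.exp (3 * μ) := by gcongr
      _ = C * Real.exp (3 * μ) * (1 + w⁻¹) / μ * (μ * 1 * (1 + w * t) / l) := by
          field_simp
      _ ≤ impurityConst C μ w * (μ * r * (1 + w * t) / l) := by
          unfold impurityConst
          gcongr
          linarith
  have h2 : Real.exp (-μ * m) = Real.exp (3 * μ) ^ n * Real.exp (-μ * r) := by
    rw [← Real.exp_nat_mul, ← Real.exp_add, ← hmr]
    congr 1
    push_cast
    ring
  calc 2 * ((C / l * (1 + t)) ^ n * ((2 * φ * t) ^ m / m.factorial))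
      = (C / l * (1 + t)) ^ n * (2 * ((2 * φ * t) ^ m / m.factorial)) := by ring
    _ ≤ (C / l * (1 + t)) ^ n * (Real.exp (w * t) * Real.exp (-μ * m)) := by
        have := two_mul_pow_div_factorial_le hm hφ ht hw
        gcongr
    _ = (C / l * (1 + t) * Real.exp (3 * μ)) ^ n * Real.exp (w * t) * Real.exp (-μ * r) := by
        rw [h2, mul_pow _ (Real.exp (3 * μ))]; ring
    _ ≤ _ := by gcongr

namespace Chain

variable {𝔸 ι : Type*} [CStarAlgebra 𝔸] [Fintype ι] [DecidableEq ι] {S : Chain 𝔸}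

variable (S) in
/-- The chain with the sign of the Hamiltonian reversed. -/
def neg : Chain 𝔸 where
  __ := S
  bond j := -S.bond j
  site j := -S.site j
  bond_sa j := (S.bond_sa j).neg
  site_sa j := (S.site_sa j).neg
  bond_right j := neg_mem (S.bond_right j)
  bond_left j := neg_mem (S.bond_left j)
  site_right j := neg_mem (S.site_right j)
  site_left j := neg_mem (S.site_left j)
  bond_vol j hj := by rw [S.bond_vol j hj, neg_zero]
  site_vol j hj := by rw [S.site_vol j hj, neg_zero]

theorem neg_ham : S.neg.ham = -S.ham := by
  simp only [ham, neg, ← Finset.sum_neg_distrib]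
  exact Finset.sum_congr rfl fun j _ => by abel

theorem IsImpurity.neg {x : ℤ} {P : ι → 𝔸} {v : ι → ℝ} {lam δ : ℝ}
    (h : S.IsImpurity x P v lam δ) : S.neg.IsImpurity x P v (-lam) δ where
  sa := h.sa
  mul := h.mul
  sum_eq_one := h.sum_eq_one
  norm_le := h.norm_le
  right := h.right
  left := h.left
  site_eq := by
    change -S.site x = _
    rw [h.site_eq]; simp
  gap := h.gap
  diag a ha hPa := by
    have h1 := h.diag a ha hPa
    have h2 : pinch P (-S.bond x) = -pinch P (S.bond x) := by simp [pinch]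
    change pinch P (-S.bond x) * a = a * pinch P (-S.bond x)
    rw [h2, neg_mul, mul_neg, h1]
  site_prev := by change -S.site (x - 1) = 0; rw [h.site_prev, neg_zero]
  site_next := by change -S.site (x + 1) = 0; rw [h.site_next, neg_zero]

/-- The Lieb-Robinson bound for a chain with impurities at the sites of `G`. -/
theorem norm_lie_evolve_impurity_le {G : Finset ℤ} {a b : ℤ} {P : ℤ → ι → 𝔸} {v : ι → ℝ}
    {lam δ φ μ w : ℝ} (hμ : 0 < μ) (hw : 8 * Real.exp μ * φ ≤ w) (hlam : lam ≠ 0) (hδ : 0 < δ)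
    (hφ : ∀ j, ‖S.bond j‖ ≤ φ) (hab : a < b) (hGa : ∀ x ∈ G, a < x) (hGb : ∀ x ∈ G, x ≤ b - 3)
    (hsep : ∀ x ∈ G, ∀ y ∈ G, x < y → x + 3 ≤ y)
    (himp : ∀ x ∈ G, S.IsImpurity x (P x) v lam δ) {A B : 𝔸} (hA : A ∈ S.left a)
    (hB : B ∈ S.right b) (t : ℝ) :
    ‖⁅evolve S.ham t A, B⁆‖ ≤
      (impurityConst (crossConst (Fintype.card ι) δ φ) μ w *
          (μ * (b - a) * (1 + w * |t|) / |lam|)) ^ G.card *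
        ‖A‖ * ‖B‖ * Real.exp (w * |t|) * Real.exp (-μ * (b - a)) := by
  wlog ht : 0 ≤ t generalizing S lam t
  · have h1 := this (S := S.neg) (lam := -lam) (neg_ne_zero.2 hlam)
      (fun j => by change ‖-S.bond j‖ ≤ φ; rw [norm_neg]; exact hφ j)
      (fun x hx => (himp x hx).neg) hA hB (-t) (by linarith)
    rwa [neg_ham, abs_neg, abs_neg, evolve_neg_neg] at h1
  have hφ0 : 0 ≤ φ := (norm_nonneg _).trans (hφ 0)
  obtain ⟨r, hr⟩ : ∃ r : ℕ, (r : ℤ) = b - a := ⟨(b - a).toNat, by omega⟩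
  have hr' : (b : ℝ) - a = r := by exact_mod_cast hr.symm
  obtain ⟨m, hm1, hm, hbd⟩ := exists_commBound hlam hδ hφ hGb hsep himp hB r (by omega)
  have ha : b - (r : ℤ) = a := by omega
  have hfil : G.filter (b - (r : ℤ) < ·) = G := by
    rw [ha]; exact Finset.filter_true_of_mem hGa
  rw [hfil] at hm hbd
  rw [ha] at hbd
  have h1 := impurity_factor_le hm1 hm hμ hφ0 ht hw
    (crossConst_nonneg (Fintype.card ι) hδ hφ0) (abs_pos.2 hlam)
  rw [hr', abs_of_nonneg ht]
  refine (hbd A hA t ht).trans ?_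
  have h2 := mul_le_mul_of_nonneg_left h1 (mul_nonneg (norm_nonneg A) (norm_nonneg B))
  calc _ = _ := by ring
    _ ≤ _ := h2
    _ = _ := by ring

end Chain

/-! ### Embeddings of local algebras -/

section Embedding

variable {D : ℕ} {X Y Z W : Finset ℤ}

/-- The configuration on `Y` that agrees with `w` on `X` and with `s` elsewhere. -/
def glue (w : X → Fin D) (s : Y → Fin D) : Y → Fin D :=
  fun y => if h : (y : ℤ) ∈ X then w ⟨y, h⟩ else s y

theorem restrictConfig_glue (h : X ⊆ Y) (w : X → Fin D) (s : Y → Fin D) :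
    restrictConfig h (glue w s) = w := by
  funext x
  simp [restrictConfig, glue]

theorem glue_of_notMem (w : X → Fin D) (s : Y → Fin D) {y : Y} (hy : (y : ℤ) ∉ X) :
    glue w s y = s y := by
  simp [glue, hy]

theorem glue_of_eq_off (h : X ⊆ Y) {s u : Y → Fin D}
    (hu : ∀ y : Y, (y : ℤ) ∉ X → s y = u y) : glue (restrictConfig h u) s = u := by
  funext y
  by_cases hy : (y : ℤ) ∈ X
  · simp [glue, hy, restrictConfig]
  · rw [glue_of_notMem _ _ hy, hu y hy]

theorem embed_apply (h : X ⊆ Y) (A : LocalAlg D X) (s t : Y → Fin D) :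
    embed h A s t = if ∀ y : Y, (y : ℤ) ∉ X → s y = t y
      then A (restrictConfig h s) (restrictConfig h t) else 0 := rfl

theorem eq_of_restrictConfig_eq (h : X ⊆ Y) {s t : Y → Fin D}
    (h1 : ∀ y : Y, (y : ℤ) ∉ X → s y = t y) (h2 : restrictConfig h s = restrictConfig h t) :
    s = t := by
  funext y
  by_cases hy : (y : ℤ) ∈ X
  · exact congrFun h2 ⟨y, hy⟩
  · exact h1 y hy

/-- The inclusion `𝒜_X → 𝒜_Y` as a homomorphism of star algebras. -/
def embedHom (h : X ⊆ Y) : LocalAlg D X →⋆ₐ[ℂ] LocalAlg D Y where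
  toFun := embed h
  map_one' := by
    ext s t
    rw [embed_apply]
    by_cases hst : s = t
    · subst hst; simp
    · rw [Matrix.one_apply_ne hst]
      split_ifs with h1
      · exact Matrix.one_apply_ne fun h2 => hst (eq_of_restrictConfig_eq h h1 h2)
      · rfl
  map_mul' A B := by
    ext s t
    rw [embed_apply, Matrix.mul_apply, Matrix.mul_apply]
    split_ifs with h1
    · refine Fintype.sum_of_injective (fun w => glue w s) (fun w w' hw => ?_) _ _
        (fun u hu => ?_) (fun w => ?_)
      · rw [← restrictConfig_glue h w s, ← restrictConfig_glue h w' s]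
        exact congrArg _ hw
      · rw [embed_apply, if_neg, zero_mul]
        exact fun h2 => hu ⟨_, glue_of_eq_off h h2⟩
      · rw [embed_apply, embed_apply, restrictConfig_glue, if_pos, if_pos]
        · exact fun y hy => by rw [glue_of_notMem _ _ hy, h1 y hy]
        · exact fun y hy => by rw [glue_of_notMem _ _ hy]
    · refine (Finset.sum_eq_zero fun u _ => ?_).symm
      rw [embed_apply, embed_apply]
      by_cases h2 : ∀ y : Y, (y : ℤ) ∉ X → s y = u y
      · rw [if_pos h2, if_neg fun h3 => h1 fun y hy => (h2 y hy).trans (h3 y hy), mul_zero]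
      · rw [if_neg h2, zero_mul]
  map_zero' := by ext s t; simp [embed_apply]
  map_add' A B := by
    ext s t
    simp only [embed_apply, Matrix.add_apply]
    split_ifs <;> simp
  commutes' c := by
    ext s t
    rw [embed_apply, Algebra.algebraMap_eq_smul_one, Algebra.algebraMap_eq_smul_one,
      Matrix.smul_apply, Matrix.smul_apply]
    by_cases hst : s = t
    · subst hst; simp
    · rw [Matrix.one_apply_ne hst]
      split_ifs with h1
      · rw [Matrix.one_apply_ne fun h2 => hst (eq_of_restrictConfig_eq h h1 h2)]
      · simp
  map_star' A := by
    ext s t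
    rw [Matrix.star_apply, embed_apply, embed_apply]
    by_cases h1 : ∀ y : Y, (y : ℤ) ∉ X → s y = t y
    · rw [if_pos h1, if_pos fun y hy => (h1 y hy).symm, Matrix.star_apply]
    · rw [if_neg h1, if_neg fun h2 => h1 fun y hy => (h2 y hy).symm, star_zero]

@[simp] theorem embedHom_apply (h : X ⊆ Y) (A : LocalAlg D X) : embedHom h A = embed h A := rfl

theorem norm_embed_le (h : X ⊆ Y) (A : LocalAlg D X) : ‖embed h A‖ ≤ ‖A‖ :=
  NonUnitalStarAlgHom.norm_apply_le (embedHom h) A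

theorem embed_embed (h : X ⊆ Z) (h' : Z ⊆ Y) (A : LocalAlg D X) :
    embed h' (embed h A) = embed (h.trans h') A := by
  ext s t
  rw [embed_apply, embed_apply, embed_apply]
  by_cases h1 : ∀ y : Y, (y : ℤ) ∉ X → s y = t y
  · have h2 : ∀ z : Z, (z : ℤ) ∉ X → restrictConfig h' s z = restrictConfig h' t z :=
      fun z hz => h1 ⟨z, h' z.2⟩ hz
    rw [if_pos h1, if_pos fun y hy => h1 y fun hx => hy (h hx), if_pos h2]
    rfl
  · rw [if_neg h1]
    split_ifs with h2 h3
    · refine absurd (fun y hy => ?_) h1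
      by_cases hz : (y : ℤ) ∈ Z
      · exact h3 ⟨y, hz⟩ hy
      · exact h2 y hz
    · rfl
    · rfl

theorem IsSupportedOn.mono {A : LocalAlg D Y} (hA : IsSupportedOn A X) (hXZ : X ⊆ Z)
    (hZY : Z ⊆ Y) : IsSupportedOn A Z := by
  obtain ⟨h, A₀, rfl⟩ := hA
  exact ⟨hZY, embed hXZ A₀, embed_embed _ _ _⟩

/-- Matrix elements of a product of observables with disjoint supports. -/
theorem embed_mul_embed_apply (hX : X ⊆ Y) (hZ : Z ⊆ Y) (hd : Disjoint X Z) (A : LocalAlg D X)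
    (B : LocalAlg D Z) (s t : Y → Fin D) :
    (embed hX A * embed hZ B) s t =
      if ∀ y : Y, (y : ℤ) ∉ X → (y : ℤ) ∉ Z → s y = t y
      then A (restrictConfig hX s) (restrictConfig hX t) *
        B (restrictConfig hZ s) (restrictConfig hZ t) else 0 := by
  rw [Matrix.mul_apply]
  have hXZ : ∀ y, y ∈ Z → y ∉ X := fun y hz hx => Finset.disjoint_left.1 hd hx hz
  have hrX : restrictConfig hX (glue (restrictConfig hX t) s) = restrictConfig hX t :=
    restrictConfig_glue _ _ _
  have hrZ : restrictConfig hZ (glue (restrictConfig hX t) s) = restrictConfig hZ s := by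
    funext z
    exact glue_of_notMem (y := ⟨z, hZ z.2⟩) _ _ (hXZ z.1 z.2)
  -- the only intermediate configuration agrees with `t` on `X` and with `s` off `X`
  rw [Finset.sum_eq_single (glue (restrictConfig hX t) s) _ (by simp)]
  · rw [embed_apply, embed_apply, if_pos fun y hy => (glue_of_notMem _ _ hy).symm, hrX, hrZ]
    by_cases h1 : ∀ y : Y, (y : ℤ) ∉ X → (y : ℤ) ∉ Z → s y = t y
    · rw [if_pos h1, if_pos]
      intro y hz
      by_cases hx : (y : ℤ) ∈ X
      · simp [glue, hx, restrictConfig]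
      · rw [glue_of_notMem _ _ hx, h1 y hx hz]
    · rw [if_neg h1, if_neg, mul_zero]
      exact fun h2 => h1 fun y hx hz => by rw [← h2 y hz, glue_of_notMem _ _ hx]
  · intro u _ hu
    rw [embed_apply, embed_apply]
    by_cases h1 : ∀ y : Y, (y : ℤ) ∉ X → s y = u y
    · rw [if_pos h1, if_neg fun h2 => hu ?_, mul_zero]
      rw [← glue_of_eq_off hX h1]
      congr 1
      funext x
      exact h2 ⟨x, hX x.2⟩ fun hz => hXZ x hz x.2
    · rw [if_neg h1, zero_mul]

theorem embed_commute (hX : X ⊆ Y) (hZ : Z ⊆ Y) (hd : Disjoint X Z) (A : LocalAlg D X)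
    (B : LocalAlg D Z) : embed hX A * embed hZ B = embed hZ B * embed hX A := by
  ext s t
  rw [embed_mul_embed_apply hX hZ hd, embed_mul_embed_apply hZ hX hd.symm]
  by_cases h1 : ∀ y : Y, (y : ℤ) ∉ X → (y : ℤ) ∉ Z → s y = t y
  · rw [if_pos h1, if_pos fun y hz hx => h1 y hx hz, mul_comm]
  · rw [if_neg h1, if_neg fun h2 => h1 fun y hx hz => h2 y hz hx]

/-- Expansion of an observable on `W = X ∪ Z` in products of matrix units on `X` and on `Z`. -/
theorem embed_eq_sum_mul (hW : W ⊆ Y) (hXW : X ⊆ W) (hZW : Z ⊆ W) (hd : Disjoint X Z)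
    (hXZ : ∀ y ∈ W, y ∈ X ∨ y ∈ Z) (A : LocalAlg D W) :
    embed hW A = ∑ p : W → Fin D, ∑ q : W → Fin D, A p q •
      (embed (hXW.trans hW) (Matrix.single (restrictConfig hXW p) (restrictConfig hXW q) 1) *
        embed (hZW.trans hW) (Matrix.single (restrictConfig hZW p) (restrictConfig hZW q) 1)) := by
  ext s t
  have hrX : ∀ s : Y → Fin D,
      restrictConfig (hXW.trans hW) s = restrictConfig hXW (restrictConfig hW s) := fun _ => rfl
  have hrZ : ∀ s : Y → Fin D,
      restrictConfig (hZW.trans hW) s = restrictConfig hZW (restrictConfig hW s) := fun _ => rfl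
  have hinj : ∀ p q : W → Fin D, restrictConfig hXW p = restrictConfig hXW q →
      restrictConfig hZW p = restrictConfig hZW q → p = q := by
    intro p q h1 h2
    funext y
    rcases hXZ y y.2 with hy | hy
    · exact congrFun h1 ⟨y, hy⟩
    · exact congrFun h2 ⟨y, hy⟩
  simp only [Matrix.sum_apply, Matrix.smul_apply, smul_eq_mul,
    embed_mul_embed_apply _ _ hd, hrX, hrZ]
  rw [embed_apply]
  by_cases h1 : ∀ y : Y, (y : ℤ) ∉ W → s y = t y
  · have h2 : ∀ y : Y, (y : ℤ) ∉ X → (y : ℤ) ∉ Z → s y = t y :=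
      fun y hx hz => h1 y fun hw => (hXZ y hw).elim hx hz
    rw [if_pos h1]
    simp only [if_pos h2]
    rw [Finset.sum_eq_single (restrictConfig hW s) _ (by simp),
      Finset.sum_eq_single (restrictConfig hW t) _ (by simp)]
    · simp
    · intro q _ hq
      simp only [Matrix.single_apply, true_and]
      split_ifs with h3 h4 <;> simp
      exact absurd (hinj _ _ h3 h4) hq
    · intro p _ hp
      refine Finset.sum_eq_zero fun q _ => ?_
      simp only [Matrix.single_apply]
      split_ifs with h3 h4 <;> simp
      exact absurd (hinj _ _ h3.1 h4.1) hp
  · have h2 : ¬ ∀ y : Y, (y : ℤ) ∉ X → (y : ℤ) ∉ Z → s y = t y :=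
      fun h2 => h1 fun y hy => h2 y (fun hx => hy (hXW hx)) (fun hz => hy (hZW hz))
    rw [if_neg h1]
    simp only [if_neg h2]
    simp

/-- Configurations on the sites `x` and `0` correspond to each other by translation. -/
def shiftConfig (D : ℕ) (x : ℤ) : (({x} : Finset ℤ) → Fin D) ≃ (({0} : Finset ℤ) → Fin D) where
  toFun s y := s ⟨y + x, by have := Finset.mem_singleton.1 y.2; simp [this]⟩
  invFun s y := s ⟨y - x, by have := Finset.mem_singleton.1 y.2; simp [this]⟩
  left_inv s := by funext y; simp
  right_inv s := by funext y; simp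

theorem translateSite_eq (x : ℤ) (A : LocalAlg D {0}) :
    translateSite x A = A.submatrix (shiftConfig D x) (shiftConfig D x) := rfl

/-- The translation `T_x` on one site as a homomorphism of star algebras. -/
def translateSiteHom (x : ℤ) : LocalAlg D {0} →⋆ₐ[ℂ] LocalAlg D {x} where
  toFun := translateSite x
  map_one' := Matrix.submatrix_one_equiv (α := ℂ) (shiftConfig D x)
  map_mul' A B := (Matrix.submatrix_mul_equiv A B _ (shiftConfig D x) _).symm
  map_zero' := rfl
  map_add' _ _ := rfl
  commutes' c := by
    rw [Algebra.algebraMap_eq_smul_one, Algebra.algebraMap_eq_smul_one]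
    exact congrArg (c • ·) (Matrix.submatrix_one_equiv (α := ℂ) (shiftConfig D x))
  map_star' _ := rfl

theorem translateSiteHom_surjective (x : ℤ) :
    Function.Surjective (translateSiteHom (D := D) x) := by
  intro A
  refine ⟨A.submatrix (shiftConfig D x).symm (shiftConfig D x).symm, ?_⟩
  change Matrix.submatrix (Matrix.submatrix A _ _) (shiftConfig D x) (shiftConfig D x) = A
  simp

end Embedding

/-- The spectral projections of a Hermitian matrix with respect to an orthonormal eigenbasis: they
have rank one, which is expressed by `P i * u * P i ∈ ℂ P i`. -/
theorem exists_spectral_projections {n : Type*} [Fintype n] [DecidableEq n] {V : Matrix n n ℂ}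
    (hV : V.IsHermitian) :
    ∃ P : n → Matrix n n ℂ, (∀ i, IsSelfAdjoint (P i)) ∧
      (∀ i j, P i * P j = if i = j then P i else 0) ∧ ∑ i, P i = 1 ∧
      V = ∑ i, (hV.eigenvalues i : ℂ) • P i ∧ ∀ i u, ∃ c : ℂ, P i * u * P i = c • P i := by
  set φ := Unitary.conjStarAlgAut ℂ (Matrix n n ℂ) hV.eigenvectorUnitary with hφ
  refine ⟨fun i => φ (Matrix.single i i 1), fun i => ?_, fun i j => ?_, ?_, ?_, fun i u => ?_⟩
  · rw [IsSelfAdjoint, ← map_star]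
    congr 1
    simp [Matrix.star_eq_conjTranspose]
  · rw [← map_mul]
    by_cases h : i = j
    · subst h; simp
    · simp [h]
  · rw [← map_sum, Matrix.sum_single_one, map_one]
  · conv_lhs => rw [hV.spectral_theorem]
    simp only [← map_smul, ← map_sum]
    rw [← Matrix.sum_single_eq_diagonal]
    exact congrArg _ (Finset.sum_congr rfl fun i _ => by simp)
  · obtain ⟨u, rfl⟩ : ∃ u', φ u' = u := ⟨φ.symm u, φ.apply_symm_apply u⟩
    refine ⟨u i i, ?_⟩
    beta_reduce
    rw [← map_mul, ← map_mul, ← map_smul]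
    congr 1
    simp

theorem norm_le_one_of_projection {𝔸 : Type*} [CStarAlgebra 𝔸] {p : 𝔸} (hp : IsSelfAdjoint p)
    (hpp : p * p = p) : ‖p‖ ≤ 1 := by
  have h := CStarRing.norm_star_mul_self (x := p)
  rw [hp.star_eq, hpp] at h
  nlinarith [norm_nonneg p]

/-! ### The spin system as a chain -/

section SpinSystem

variable {D : ℕ}

/-- The part of the volume `[-L, L]` in `[k, ∞)`. -/
noncomputable def rightBox (L : ℕ) (k : ℤ) : Finset ℤ := (box L).filter (k ≤ ·)

theorem rightBox_subset (L : ℕ) (k : ℤ) : rightBox L k ⊆ box L := Finset.filter_subset _ _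

/-- The algebra of the observables on the sites `≥ k` of `[-L, L]`. -/
noncomputable def rightAlg (D L : ℕ) (k : ℤ) : Subalgebra ℂ (LocalAlg D (box L)) :=
  (embedHom (rightBox_subset L k)).toAlgHom.range

theorem mem_rightAlg {L : ℕ} {k : ℤ} {A : LocalAlg D (box L)} :
    A ∈ rightAlg D L k ↔ IsSupportedOn A (rightBox L k) :=
  ⟨fun ⟨A₀, h⟩ => ⟨rightBox_subset L k, A₀, h⟩, fun ⟨_, A₀, h⟩ => ⟨A₀, h⟩⟩

theorem IsSupportedOn.mem_rightAlg {L : ℕ} {k : ℤ} {A : LocalAlg D (box L)} {X : Finset ℤ}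
    (hA : IsSupportedOn A X) (hX : ∀ x ∈ X, k ≤ x) : A ∈ rightAlg D L k :=
  SpinChain.mem_rightAlg.2 <| hA.mono
    (fun x hx => Finset.mem_filter.2 ⟨hA.choose hx, hX x hx⟩) (rightBox_subset L k)

theorem IsSupportedOn.mem_centralizer {L : ℕ} {k : ℤ} {A : LocalAlg D (box L)} {X : Finset ℤ}
    (hA : IsSupportedOn A X) (hX : ∀ x ∈ X, x < k) :
    A ∈ Subalgebra.centralizer ℂ (rightAlg D L k : Set (LocalAlg D (box L))) := by
  rw [Subalgebra.mem_centralizer_iff]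
  intro y hy
  obtain ⟨_, A₀, rfl⟩ := hA
  obtain ⟨_, B₀, rfl⟩ := SpinChain.mem_rightAlg.1 hy
  refine embed_commute _ _ (Finset.disjoint_left.2 fun x hx hx' => ?_) _ _
  have h1 := (Finset.mem_filter.1 hx).2
  have h2 := hX x hx'
  omega

theorem isSelfAdjoint_embed {X Y : Finset ℤ} (h : X ⊆ Y) {A : LocalAlg D X} (hA : A.IsHermitian) :
    IsSelfAdjoint (embed h A) := by
  have h1 : star A = A := hA
  rw [IsSelfAdjoint, ← embedHom_apply, ← map_star, h1]

/-- The bond term `Φ_{j,j+1}` in `𝒜_L`, and `0` for the bonds that leave the volume. -/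
noncomputable def boxBond (Φ : Interaction D) (L : ℕ) (j : ℤ) : LocalAlg D (box L) :=
  if h : j ∈ Finset.Ico (-(L : ℤ)) L then embed (bond_subset_box h) (Φ.bond j) else 0

open Classical in
/-- The impurity `λ_x V_x` in `𝒜_L`, and `0` where there is none. -/
noncomputable def boxSite (F : Set ℤ) (V : ∀ x : ℤ, LocalAlg D {x}) (lam : ℤ → ℝ) (L : ℕ)
    (j : ℤ) : LocalAlg D (box L) :=
  if h : j ∈ box L then
    if j ∈ F then (lam j : ℂ) • embed (Finset.singleton_subset_iff.2 h) (V j) else 0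
  else 0

theorem boxBond_mem {Φ : Interaction D} {L : ℕ} (S : ℤ → Subalgebra ℂ (LocalAlg D (box L)))
    (hS : ∀ j (A : LocalAlg D (box L)), IsSupportedOn A {j, j + 1} → A ∈ S j) (j : ℤ) :
    boxBond Φ L j ∈ S j := by
  unfold boxBond
  split_ifs with h
  · exact hS j _ ⟨_, _, rfl⟩
  · exact zero_mem _

theorem boxSite_mem {F : Set ℤ} {V : ∀ x : ℤ, LocalAlg D {x}} {lam : ℤ → ℝ} {L : ℕ}
    (S : ℤ → Subalgebra ℂ (LocalAlg D (box L)))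
    (hS : ∀ j (A : LocalAlg D (box L)), IsSupportedOn A {j} → A ∈ S j) (j : ℤ) :
    boxSite F V lam L j ∈ S j := by
  unfold boxSite
  split_ifs with h
  · exact Subalgebra.smul_mem _ (hS j _ ⟨_, _, rfl⟩) _
  · exact zero_mem _
  · exact zero_mem _

/-- The spin system on `[-L, L]` as a chain. -/
noncomputable def boxChain (Φ : Interaction D) (F : Set ℤ) (V : ∀ x : ℤ, LocalAlg D {x})
    (hV : ∀ x ∈ F, (V x).IsHermitian) (lam : ℤ → ℝ) (L : ℕ) : Chain (LocalAlg D (box L)) where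
  right := rightAlg D L
  right_anti j k hjk A hA := (mem_rightAlg.1 hA).mem_rightAlg fun x hx =>
    hjk.trans (Finset.mem_filter.1 hx).2
  bond := boxBond Φ L
  site := boxSite F V lam L
  vol := box L
  bond_sa j := by
    unfold boxBond
    split_ifs with h
    · exact isSelfAdjoint_embed _ (Φ.isHermitian _)
    · exact IsSelfAdjoint.zero _
  site_sa j := by
    unfold boxSite
    split_ifs with h h1
    · refine IsSelfAdjoint.smul ?_ (isSelfAdjoint_embed _ (hV j h1))
      exact Complex.conj_ofReal _
    · exact IsSelfAdjoint.zero _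
    · exact IsSelfAdjoint.zero _
  bond_right := boxBond_mem (rightAlg D L) fun j _ hA => hA.mem_rightAlg (by simp)
  bond_left := boxBond_mem (fun j => Subalgebra.centralizer ℂ (rightAlg D L (j + 2) : Set (LocalAlg D (box L))))
    fun j _ hA => hA.mem_centralizer fun x hx => by
      simp only [Finset.mem_insert, Finset.mem_singleton] at hx
      omega
  site_right := boxSite_mem (rightAlg D L) fun j _ hA => hA.mem_rightAlg (by simp)
  site_left := boxSite_mem (fun j => Subalgebra.centralizer ℂ (rightAlg D L (j + 1) : Set (LocalAlg D (box L))))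
    fun j _ hA => hA.mem_centralizer fun x hx => by
      have := Finset.mem_singleton.1 hx
      omega
  bond_vol j hj := dif_neg fun h => hj (by
    have := Finset.mem_Ico.1 h
    exact Finset.mem_Icc.2 ⟨this.1, this.2.le⟩)
  site_vol j hj := dif_neg hj

variable {Φ : Interaction D} {F : Set ℤ} {V : ∀ x : ℤ, LocalAlg D {x}}
  {hV : ∀ x ∈ F, (V x).IsHermitian} {lam : ℤ → ℝ} {L : ℕ}

theorem boxChain_ham : (boxChain Φ F V hV lam L).ham = hamiltonian Φ F V lam L := by
  classical
  change ∑ j ∈ box L, (boxBond Φ L j + boxSite F V lam L j) = _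
  rw [Finset.sum_add_distrib, hamiltonian]
  congr 1
  · rw [bulkHamiltonian]
    have h1 : ∑ j ∈ box L, boxBond Φ L j = ∑ j ∈ Finset.Ico (-(L : ℤ)) L, boxBond Φ L j := by
      refine (Finset.sum_subset (fun j hj => ?_) fun j _ hj => dif_neg hj).symm
      have := Finset.mem_Ico.1 hj
      exact Finset.mem_Icc.2 ⟨this.1, this.2.le⟩
    rw [h1, ← Finset.sum_coe_sort]
    exact Finset.sum_congr rfl fun j _ => dif_pos j.2
  · rw [impurityHamiltonian, ← Finset.sum_coe_sort]
    exact Finset.sum_congr rfl fun j _ => dif_pos j.2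

theorem norm_boxBond_le (hΦ : Φ.IsBounded) (j : ℤ) : ‖boxBond Φ L j‖ ≤ Φ.bondNorm := by
  have h0 : ‖Φ.bond j‖ ≤ Φ.bondNorm := le_ciSup hΦ j
  unfold boxBond
  split_ifs with h
  · exact (norm_embed_le _ _).trans h0
  · rw [norm_zero]
    exact (norm_nonneg _).trans h0

/-- The embedding of the one-site algebra at the site `x`. -/
noncomputable def siteHom {x : ℤ} (hx : x ∈ box L) : LocalAlg D {0} →⋆ₐ[ℂ] LocalAlg D (box L) :=
  (embedHom (Finset.singleton_subset_iff.2 hx)).comp (translateSiteHom x)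

/-- Pinching the bond to the right of `x` with rank-one projections on the site `x` leaves only
operators on the sites `> x` and the projections themselves. -/
theorem pinch_boxBond_commute {x : ℤ} (hx : x ∈ box L) {ι : Type*} [Fintype ι]
    {p : ι → LocalAlg D {0}} (hrank : ∀ i u, ∃ c : ℂ, p i * u * p i = c • p i)
    {a : LocalAlg D (box L)}
    (ha : a ∈ Subalgebra.centralizer ℂ (rightAlg D L (x + 1) : Set (LocalAlg D (box L))))
    (hap : ∀ i, siteHom hx (p i) * a = a * siteHom hx (p i)) :
    pinch (fun i => siteHom hx (p i)) (boxBond Φ L x) * a =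
      a * pinch (fun i => siteHom hx (p i)) (boxBond Φ L x) := by
  unfold boxBond
  split_ifs with h
  swap
  · simp [pinch]
  rw [Subalgebra.mem_centralizer_iff] at ha
  have hsupp : ∀ i, IsSupportedOn (siteHom hx (p i)) {x} := fun i => ⟨_, _, rfl⟩
  rw [embed_eq_sum_mul (bond_subset_box h) (X := {x}) (Z := {x + 1}) (by simp) (by simp) (by simp)
    (by simp) (Φ.bond x)]
  simp only [pinch, Finset.mul_sum, Finset.sum_mul]
  refine Finset.sum_congr rfl fun i _ => Finset.sum_congr rfl fun s _ =>
    Finset.sum_congr rfl fun t _ => ?_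
  set y : LocalAlg D (box L) := embed _ (Matrix.single (restrictConfig _ s) (restrictConfig _ t) 1)
    with hy
  set z : LocalAlg D (box L) := embed ((show ({x + 1} : Finset ℤ) ⊆ {x, x + 1} by simp).trans
    (bond_subset_box h)) (Matrix.single (restrictConfig _ s) (restrictConfig _ t) 1) with hz
  have hzr : z ∈ rightAlg D L (x + 1) :=
    IsSupportedOn.mem_rightAlg (X := {x + 1}) ⟨_, _, rfl⟩ (by simp)
  have hPz : z * siteHom hx (p i) = siteHom hx (p i) * z :=
    Subalgebra.mem_centralizer_iff ℂ |>.1 ((hsupp i).mem_centralizer (by simp)) z hzr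
  obtain ⟨u, hu⟩ : ∃ u, siteHom hx u = y := by
    obtain ⟨u, hu⟩ := (translateSiteHom_surjective (D := D) x)
      (Matrix.single (restrictConfig (by simp) s) (restrictConfig (by simp) t) 1)
    exact ⟨u, congrArg (embed _) hu⟩
  obtain ⟨c, hc⟩ := hrank i u
  have h1 : siteHom hx (p i) * (Φ.bond x s t • (y * z)) * siteHom hx (p i) =
      (Φ.bond x s t * c) • (siteHom hx (p i) * z) := by
    rw [mul_smul_comm, smul_mul_assoc, mul_smul, ← smul_mul_assoc c, ← map_smul, ← hc, map_mul,
      map_mul, hu, ← mul_assoc, mul_assoc _ z, hPz, mul_assoc _ _ z]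
  rw [h1, smul_mul_assoc, mul_smul_comm, mul_assoc, ha z hzr, ← mul_assoc, hap, mul_assoc]

end SpinSystem

/-! ### The constant `K_μ` and distances of sites -/

theorem summable_inv_one_add_abs_sq (x : ℤ) :
    Summable fun z : ℤ => ((1 + |(x : ℝ) - z|) ^ 2)⁻¹ := by
  have h0 : Summable fun z : ℤ => ((1 + |(z : ℝ)|) ^ 2)⁻¹ := by
    have h1 : Summable fun n : ℕ => ((1 + (n : ℝ)) ^ 2)⁻¹ := by
      have h2 := (summable_nat_add_iff 1).2 (Real.summable_nat_pow_inv.2 (by norm_num : 1 < 2))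
      refine h2.congr fun n => ?_
      push_cast
      ring
    refine Summable.of_nat_of_neg ?_ ?_
    · exact h1.congr fun n => by simp
    · exact h1.congr fun n => by simp
  have h3 := ((Equiv.subLeft x).summable_iff).2 h0
  refine h3.congr fun z => ?_
  simp

theorem tsum_inv_one_add_abs_sq (x : ℤ) :
    ∑' z : ℤ, ((1 + |(x : ℝ) - z|) ^ 2)⁻¹ = ∑' z : ℤ, ((1 + |(z : ℝ)|) ^ 2)⁻¹ := by
  rw [← (Equiv.subLeft x).tsum_eq fun z : ℤ => ((1 + |(z : ℝ)|) ^ 2)⁻¹]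
  simp

/-- The sums in the definition of `K_μ` are bounded because `1 + |x - y|` is at most the sum of
`1 + |x - z|` and `1 + |z - y|`. -/
theorem convConst_term_le {μ : ℝ} (hμ : 0 < μ) (x y z : ℤ) :
    Real.exp (-μ * (|(x : ℝ) - z| + |(y : ℝ) - z| - |(x : ℝ) - y|)) * (1 + |(x : ℝ) - y|) ^ 2 /
        ((1 + |(x : ℝ) - z|) ^ 2 * (1 + |(z : ℝ) - y|) ^ 2) ≤
      2 * ((1 + |(x : ℝ) - z|) ^ 2)⁻¹ + 2 * ((1 + |(y : ℝ) - z|) ^ 2)⁻¹ := by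
  rw [abs_sub_comm (z : ℝ) y]
  have htri : |(x : ℝ) - y| ≤ |(x : ℝ) - z| + |(y : ℝ) - z| := by
    rw [abs_sub_comm (y : ℝ) z]; exact abs_sub_le _ _ _
  set p := |(x : ℝ) - z| with hp
  set q := |(y : ℝ) - z| with hq
  have hp0 : 0 ≤ p := abs_nonneg _
  have hq0 : 0 ≤ q := abs_nonneg _
  have h0 : 0 ≤ |(x : ℝ) - y| := abs_nonneg _
  have h1 : Real.exp (-μ * (p + q - |(x : ℝ) - y|)) ≤ 1 := by
    rw [Real.exp_le_one_iff]
    nlinarith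
  have h2 : (1 + |(x : ℝ) - y|) ^ 2 ≤ 2 * (1 + p) ^ 2 + 2 * (1 + q) ^ 2 := by
    nlinarith [sq_nonneg (p - q)]
  rw [div_le_iff₀ (by positivity)]
  calc _ ≤ 1 * (1 + |(x : ℝ) - y|) ^ 2 := by gcongr
    _ ≤ 2 * (1 + p) ^ 2 + 2 * (1 + q) ^ 2 := by rw [one_mul]; exact h2
    _ = _ := by field_simp; ring

/-- `K_μ ≥ 1`, by the term `x = y = z`. -/
theorem one_le_convConst {μ : ℝ} (hμ : 0 < μ) : 1 ≤ convConst μ := by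
  set f : ℤ × ℤ → ℤ → ℝ := fun p z =>
    Real.exp (-μ * (|(p.1 : ℝ) - z| + |(p.2 : ℝ) - z| - |(p.1 : ℝ) - p.2|)) *
        (1 + |(p.1 : ℝ) - p.2|) ^ 2 /
      ((1 + |(p.1 : ℝ) - z|) ^ 2 * (1 + |(z : ℝ) - p.2|) ^ 2) with hf
  have hf0 : ∀ p z, 0 ≤ f p z := fun p z => by simp only [hf]; positivity
  have hdom : ∀ p : ℤ × ℤ, Summable fun z : ℤ =>
      2 * ((1 + |(p.1 : ℝ) - z|) ^ 2)⁻¹ + 2 * ((1 + |(p.2 : ℝ) - z|) ^ 2)⁻¹ := fun p =>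
    ((summable_inv_one_add_abs_sq p.1).mul_left 2).add
      ((summable_inv_one_add_abs_sq p.2).mul_left 2)
  have hsum : ∀ p, Summable (f p) := fun p =>
    Summable.of_nonneg_of_le (hf0 p) (fun z => convConst_term_le hμ p.1 p.2 z) (hdom p)
  have hbdd : BddAbove (Set.range fun p : ℤ × ℤ => ∑' z, f p z) := by
    refine ⟨4 * ∑' z : ℤ, ((1 + |(z : ℝ)|) ^ 2)⁻¹, ?_⟩
    rintro _ ⟨p, rfl⟩
    refine ((hsum p).tsum_le_tsum (fun z => convConst_term_le hμ p.1 p.2 z) (hdom p)).trans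
      (le_of_eq ?_)
    rw [((summable_inv_one_add_abs_sq p.1).mul_left 2).tsum_add
      ((summable_inv_one_add_abs_sq p.2).mul_left 2), tsum_mul_left, tsum_mul_left,
      tsum_inv_one_add_abs_sq, tsum_inv_one_add_abs_sq]
    ring
  have h1 : f (0, 0) 0 = 1 := by simp [hf]
  calc (1 : ℝ) = f (0, 0) 0 := h1.symm
    _ ≤ ∑' z, f (0, 0) z := (hsum _).le_tsum 0 fun z _ => hf0 _ z
    _ ≤ convConst μ := le_ciSup hbdd (0, 0)

theorem setDist_Icc {a a' b b' : ℤ} (ha : a ≤ a') (hb : b ≤ b') (hab : a' < b) :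
    setDist (Set.Icc a a') (Set.Icc b b') = (b : ℝ) - a' := by
  have habR : (a' : ℝ) < b := by exact_mod_cast hab
  refine IsLeast.csInf_eq ⟨⟨a', ⟨ha, le_rfl⟩, b, ⟨le_rfl, hb⟩, ?_⟩, ?_⟩
  · rw [abs_sub_comm, abs_of_pos (by linarith)]
  · rintro _ ⟨x, hx, y, hy, rfl⟩
    have hxR : (x : ℝ) ≤ a' := by exact_mod_cast hx.2
    have hyR : (b : ℝ) ≤ y := by exact_mod_cast hy.1
    rw [abs_sub_comm]
    exact le_trans (by linarith) (le_abs_self _)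

theorem add_three_le_of_einfsep {F : Set ℤ} {r : ℝ} (hF : ENNReal.ofReal (max r 2) < F.einfsep)
    {x y : ℤ} (hx : x ∈ F) (hy : y ∈ F) (hxy : x < y) : x + 3 ≤ y := by
  have h1 := hF.trans_le (Set.einfsep_le_edist_of_mem hx hy hxy.ne)
  rw [edist_dist, ENNReal.ofReal_lt_ofReal_iff_of_nonneg (by positivity), Int.dist_eq] at h1
  have h2 : (2 : ℝ) < |(x : ℝ) - y| := (le_max_right _ _).trans_lt h1
  have h3 : (2 : ℤ) < |x - y| := by exact_mod_cast h2
  rw [abs_sub_comm, abs_of_pos (by omega)] at h3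
  omega

/-! ### Impurities of the spin system -/

/-- The one-site data of a nondegenerate observable: its spectral projections and a lower bound for
the gaps between its eigenvalues. -/
theorem IsNondegenerate.exists_projections {D : ℕ} {V₀ : LocalAlg D {0}}
    (h : IsNondegenerate V₀) (hD : 0 < D) :
    ∃ (p : (({0} : Finset ℤ) → Fin D) → LocalAlg D {0})
      (v : (({0} : Finset ℤ) → Fin D) → ℝ) (δ : ℝ), 0 < δ ∧ V₀.IsHermitian ∧
      (∀ i, IsSelfAdjoint (p i)) ∧ (∀ i j, p i * p j = if i = j then p i else 0) ∧
      ∑ i, p i = 1 ∧ V₀ = ∑ i, (v i : ℂ) • p i ∧ (∀ i u, ∃ c : ℂ, p i * u * p i = c • p i) ∧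
      ∀ i j, i ≠ j → δ ≤ |v i - v j| := by
  obtain ⟨hV, hinj⟩ := h
  obtain ⟨p, h1, h2, h3, h4, h5⟩ := exists_spectral_projections hV
  set v := hV.eigenvalues
  have : Nonempty (({0} : Finset ℤ) → Fin D) := ⟨fun _ => ⟨0, hD⟩⟩
  obtain ⟨q, hq⟩ := Finite.exists_min
    fun q : (({0} : Finset ℤ) → Fin D) × (({0} : Finset ℤ) → Fin D) =>
      if q.1 = q.2 then (1 : ℝ) else |v q.1 - v q.2|
  refine ⟨p, v, _, ?_, hV, h1, h2, h3, h4, h5, fun i j hij => (hq (i, j)).trans_eq (if_neg hij)⟩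
  split_ifs with h6
  · exact one_pos
  · exact abs_pos.2 (sub_ne_zero.2 fun h7 => h6 (hinj h7))

/-- The sites of `F` in the volume are impurities of the chain. -/
theorem boxChain_isImpurity {D : ℕ} {Φ : Interaction D} {F : Set ℤ} {V : ∀ x : ℤ, LocalAlg D {x}}
    {hV : ∀ x ∈ F, (V x).IsHermitian} {lam : ℤ → ℝ} {L : ℕ} {ι : Type*} [Fintype ι]
    [DecidableEq ι] {V₀ : LocalAlg D {0}} {p : ι → LocalAlg D {0}} {v : ι → ℝ} {lam₀ δ : ℝ}
    (hsa : ∀ i, IsSelfAdjoint (p i)) (hmul : ∀ i j, p i * p j = if i = j then p i else 0)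
    (hsum : ∑ i, p i = 1) (hV₀ : V₀ = ∑ i, (v i : ℂ) • p i)
    (hrank : ∀ i u, ∃ c : ℂ, p i * u * p i = c • p i) (hgap : ∀ i j, i ≠ j → δ ≤ |v i - v j|)
    (hsep : ∀ x ∈ F, ∀ y ∈ F, x < y → x + 3 ≤ y) {x : ℤ} (hxF : x ∈ F)
    (hVx : V x = translateSite x V₀) (hlam : lam x = lam₀) (hx : x ∈ box L) :
    (boxChain Φ F V hV lam L).IsImpurity x (fun i => siteHom hx (p i)) v lam₀ δ := by
  have hsite : ∀ y, y ∉ F → boxSite F V lam L y = 0 := fun y hy => by simp [boxSite, hy]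
  have hP : ∀ i, IsSupportedOn (siteHom hx (p i)) {x} := fun i => ⟨_, _, rfl⟩
  have hPsa : ∀ i, IsSelfAdjoint (siteHom hx (p i)) := fun i => by
    rw [IsSelfAdjoint, ← map_star, (hsa i).star_eq]
  have hPmul : ∀ i j, siteHom hx (p i) * siteHom hx (p j) =
      if i = j then siteHom hx (p i) else 0 := fun i j => by
    rw [← map_mul, hmul]
    split_ifs <;> simp
  refine ⟨hPsa, hPmul, by rw [← map_sum, hsum, map_one], fun i => ?_, fun i => ?_, fun i => ?_,
    ?_, hgap, fun a ha hap => pinch_boxBond_commute hx hrank ha hap, ?_, ?_⟩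
  · exact norm_le_one_of_projection (hPsa i) (by rw [hPmul, if_pos rfl])
  · exact (hP i).mem_rightAlg (by simp)
  · exact (hP i).mem_centralizer (by simp)
  · change boxSite F V lam L x = _
    rw [boxSite, dif_pos hx, if_pos hxF, hlam, hVx]
    congr 1
    change siteHom hx V₀ = _
    rw [hV₀, map_sum]
    exact Finset.sum_congr rfl fun i _ => map_smul _ _ _
  · refine hsite _ fun h => ?_
    have := hsep _ h x hxF (by omega)
    omega
  · refine hsite _ fun h => ?_
    have := hsep x hxF _ h (by omega)
    omega

end SpinChain

theorem corollary3p2 (D : ℕ) (hD : 2 ≤ D) (μ : ℝ) (hμ : 0 < μ)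
    (Φ : SpinChain.Interaction D) (hΦ : Φ.IsNearestNeighbor) (hΦb : Φ.IsBounded)
    (V₀ : SpinChain.LocalAlg D {0}) (hV₀ : SpinChain.IsNondegenerate V₀) :
    ∃ K : ℝ, 0 < K ∧
      ∀ (F : Set ℤ), ENNReal.ofReal (max (1 / μ) 2) < F.einfsep →
      ∀ (V : ∀ x : ℤ, SpinChain.LocalAlg D {x}),
        (∀ x ∈ F, V x = SpinChain.translateSite x V₀) →
      ∀ (lam₀ : ℝ), lam₀ ≠ 0 →
      ∀ (lam : ℤ → ℝ), (∀ x ∈ F, lam x = lam₀) →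
      ∀ (L : ℕ) (A B : SpinChain.LocalAlg D (SpinChain.box L)) (a a' b b' : ℤ),
        SpinChain.IsSupport A a a' → SpinChain.IsSupport B b b' → a' + 3 < b - 3 →
      ∀ t : ℝ,
        ‖⁅SpinChain.heisenberg (SpinChain.hamiltonian Φ F V lam L) t A, B⁆‖ ≤
          (K * (μ * SpinChain.setDist (Set.Icc a a') (Set.Icc b b') *
              (1 + SpinChain.velocity μ Φ * |t|) / |lam₀|)) ^
                (Set.Icc (a' + 3) (b - 3) ∩ F).ncard *
            ‖A‖ * ‖B‖ * Real.exp (SpinChain.velocity μ Φ * |t|) *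
            Real.exp (-μ * SpinChain.setDist (Set.Icc a a') (Set.Icc b b')) := by
  classical
  obtain ⟨p, v, δ, hδ, hV₀h, hsa, hmul, hsum, hV₀p, hrank, hgap⟩ :=
    hV₀.exists_projections (by omega : 0 < D)
  have hφ0 : 0 ≤ Φ.bondNorm := (norm_nonneg _).trans (le_ciSup hΦb 0)
  -- the exponent is at least `8 e^μ ‖Φ‖` since `K_μ ≥ 1`
  have hw : 8 * Real.exp μ * Φ.bondNorm ≤ SpinChain.velocity μ Φ := by
    have h1 := mul_le_mul_of_nonneg_left (SpinChain.one_le_convConst hμ)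
      (by positivity : 0 ≤ 8 * Real.exp μ)
    rw [mul_one] at h1
    exact mul_le_mul_of_nonneg_right h1 hφ0
  have hw0 : 0 ≤ SpinChain.velocity μ Φ := le_trans (by positivity) hw
  refine ⟨SpinChain.impurityConst
    (SpinChain.Chain.crossConst (Fintype.card (({0} : Finset ℤ) → Fin D)) δ Φ.bondNorm) μ
    (SpinChain.velocity μ Φ), ?_, ?_⟩
  · have := SpinChain.Chain.crossConst_nonneg (Fintype.card (({0} : Finset ℤ) → Fin D)) hδ hφ0
    unfold SpinChain.impurityConst
    positivity
  intro F hF V hV lam₀ hlam₀ lam hlam L A B a a' b b' hA hB hab t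
  obtain ⟨haa', hAs, -⟩ := hA
  obtain ⟨hbb', hBs, -⟩ := hB
  have hsep : ∀ x ∈ F, ∀ y ∈ F, x < y → x + 3 ≤ y := fun x hx y hy =>
    SpinChain.add_three_le_of_einfsep hF hx hy
  have hVh : ∀ x ∈ F, (V x).IsHermitian := fun x hx => by
    rw [hV x hx, SpinChain.translateSite_eq]
    exact hV₀h.submatrix _
  have ha' := Finset.mem_Icc.1 (hAs.choose (Finset.right_mem_Icc.2 haa'))
  have hb := Finset.mem_Icc.1 (hBs.choose (Finset.left_mem_Icc.2 hbb'))
  set G : Finset ℤ := (Finset.Icc (a' + 3) (b - 3)).filter (· ∈ F) with hG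
  have hGm : ∀ x ∈ G, (a' + 3 ≤ x ∧ x ≤ b - 3) ∧ x ∈ F := fun x hx => by
    rw [hG, Finset.mem_filter, Finset.mem_Icc] at hx
    exact hx
  have hGbox : ∀ x ∈ G, x ∈ SpinChain.box L := fun x hx => by
    have := hGm x hx
    exact Finset.mem_Icc.2 ⟨by omega, by omega⟩
  have hcard : (Set.Icc (a' + 3) (b - 3) ∩ F).ncard = G.card := by
    rw [← Set.ncard_coe_finset]
    congr 1
    ext x
    simp [hG]
  rw [SpinChain.setDist_Icc haa' hbb' (by omega), hcard, ← SpinChain.boxChain_ham (hV := hVh)]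
  have key := SpinChain.Chain.norm_lie_evolve_impurity_le (G := G)
    (S := SpinChain.boxChain Φ F V hVh lam L) (A := A) (B := B)
    (P := fun x i => if h : x ∈ SpinChain.box L then SpinChain.siteHom h (p i) else 0)
    hμ hw hlam₀ hδ (SpinChain.norm_boxBond_le hΦb) (by omega) (fun x hx => by
      have := hGm x hx
      omega) (fun x hx => (hGm x hx).1.2)
    (fun x hx y hy => hsep x (hGm x hx).2 y (hGm y hy).2)
    (fun x hx => by
      simp only [dif_pos (hGbox x hx)]
      exact SpinChain.boxChain_isImpurity hsa hmul hsum hV₀p hrank hgap hsep (hGm x hx).2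
        (hV x (hGm x hx).2) (hlam x (hGm x hx).2) (hGbox x hx))
    (hAs.mem_centralizer fun x hx => Int.lt_add_one_of_le (Finset.mem_Icc.1 hx).2)
    (hBs.mem_rightAlg fun x hx => (Finset.mem_Icc.1 hx).1) t
  exact key
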